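/- **Theorem (discrete Malliavin–Stein bound).** *Setting.* Let $0<p_k<1$, $q_k:=1-p_k$ for $k\in\mathbb N$, and let $P:=\bigotimes_{k}(p_k\delta_{+1}+q_k\delta_{-1})$ on $\Omega:=\{-1,+1\}^{\mathbb N}$. Put $X_k(\omega):=\omega_k$ and $Y_k:=(X_k-p_k+q_k)/(2\sqrt{p_kq_k})$. For $n\ge 1$ and a symmetric, square-summable kernel $f:\mathbb N^n\to\mathbb R$ that vanishes whenever two of its arguments coincide, let $J_n(f):=\sum_{(i_1,\dots,i_n)\in\mathbb N^n}f(i_1,\dots,i_n)\,Y_{i_1}\cdots Y_{i_n}$ (convergence in $L^2(\Omega)$). Every $F\in L^2(\Omega)$ has a decomposition $F=\mathbb E[F]+\sum_{n\ge1}J_n(f_n)$ with uniquely determined kernels $f_n$ of this kind. Write $F\in\mathrm{dom}(D)$ if $F\in L^2(\Omega)$ and $\sum_{n\ge1}n\,n!\,\|f_n\|_{\ell^2(\mathbb N^n)}^2<\infty$. Let $DF:=(D_kF)_{k\in\mathbb N}$ with $D_kF(\omega):=\sqrt{p_kq_k}\,\bigl(F(\omega^k_+)-F(\omega^k_-)\bigr)$,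 where $\omega^k_\pm$ is $\omega$ with its $k$-th coordinate replaced by $\pm1$, and, for centred $F\in L^2(\Omega)$, let $L^{-1}F:=-\sum_{n\ge1}\frac1n J_n(f_n)$. For real sequences $u,v$ write $\langle u,v\rangle:=\sum_k u_kv_k$; products, powers and absolute values of sequences are taken componentwise. For $g:\mathbb R^d\to\mathbb R$ let $M_k(g):=\max_{i_1,\dots,i_k}\sup_{x\in\mathbb R^d}\bigl|\frac{\partial^k g}{\partial x_{i_1}\cdots\partial x_{i_k}}(x)\bigr|$, and for $\mathbb R^d$-valued random vectors $\mathbf U,\mathbf V$ let $d_4(\mathbf U,\mathbf V):=\sup_g|\mathbb E[g(\mathbf U)]-\mathbb E[g(\mathbf V)]|$, the supremum running over all four times partially differentiable $g:\mathbb R^d\to\mathbb R$ with $M_1(g),M_2(g),M_3(g),M_4(g)\le1$. *Statement.* Let $d\in\mathbb N$ and let $F_1,\dots,F_d\in\mathrm{dom}(D)$ satisfy $\mathbb E[F_i]=0$ and $\mathbb E\bigl[\sum_k|(p_kq_k)^{-1/4}D_kF_i|^4\bigr]<\infty$ for every $i$. Put $\mathbf F:=(F_1,\dots,F_d)$ and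 let $\mathbf N=(N_1,\dots,N_d)$ be a centred Gaussian random vector (on any probability space) with positive semidefinite, possibly degenerate, covariance matrix $\Sigma=(\Sigma_{ij})$. Then $$d_4(\mathbf F,\mathbf N)\le A_1+A_2+A_3,$$ where, with all three quantities understood as elements of $[0,\infty]$, $$A_1:=\frac12\sum_{i,j=1}^d\mathbb E\bigl[\,|\Sigma_{ij}-\langle DF_j,-DL^{-1}F_i\rangle|\,\bigr],$$ $$A_2:=\frac14\,\mathbb E\Bigl[\Bigl\langle\frac{|p-q|}{\sqrt{pq}}\Bigl(\sum_{j=1}^d|DF_j|\Bigr)^2,\ \sum_{i=1}^d|-DL^{-1}F_i|\Bigr\rangle\Bigr],$$ $$A_3:=\frac5{24}\,\mathbb E\Bigl[\Bigl\langle\frac1{pq}\Bigl(\sum_{j=1}^d|DF_j|\Bigr)^3,\ \sum_{i=1}^d|-DL^{-1}F_i|\Bigr\rangle\Bigr].$$ -/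

import Mathlib

open MeasureTheory ProbabilityTheory
open scoped ENNReal

noncomputable section

namespace Rademacher

/-- The sample space `{-1,+1}^ℕ`; `true` stands for `+1` and `false` for `-1`. -/
abbrev Omega : Type := ℕ → Bool

/-- Sequences of success probabilities `0 < p_k < 1`. -/
abbrev SuccessProb : Type := ℕ → Set.Ioo (0 : ℝ) 1

/-- The law `p δ_{+1} + (1 - p) δ_{-1}` of a single coordinate. -/
def coordMeasure (p : Set.Ioo (0 : ℝ) 1) : Measure Bool :=
  ENNReal.ofReal p • Measure.dirac true + ENNReal.ofReal (1 - p) • Measure.dirac false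

instance (p : Set.Ioo (0 : ℝ) 1) : IsProbabilityMeasure (coordMeasure p) := by
  constructor
  have h0 : (0 : ℝ) ≤ p := p.2.1.le
  have h1 : (0 : ℝ) ≤ 1 - (p : ℝ) := sub_nonneg.2 p.2.2.le
  simp [coordMeasure, ← ENNReal.ofReal_add h0 h1]

/-- The product probability measure `P` on `{-1,+1}^ℕ`. -/
abbrev P (p : SuccessProb) : Measure Omega :=
  Measure.infinitePi fun k => coordMeasure (p k)

/-- `p_k q_k`, with `q_k = 1 - p_k`. -/
def pq (p : SuccessProb) (k : ℕ) : ℝ := (p k : ℝ) * (1 - p k)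

/-- `p_k - q_k`, with `q_k = 1 - p_k`. -/
def pSubQ (p : SuccessProb) (k : ℕ) : ℝ := (p k : ℝ) - (1 - p k)

/-- The Rademacher sequence `X_k(ω) = ω_k`, as a real number. -/
def X (k : ℕ) (ω : Omega) : ℝ := if ω k then 1 else -1

/-- The standardized sequence `Y_k = (X_k - p_k + q_k) / (2 √(p_k q_k))`. -/
def Y (p : SuccessProb) (k : ℕ) (ω : Omega) : ℝ :=
  (X k ω - pSubQ p k) / (2 * √(pq p k))

lemma measurable_Y (p : SuccessProb) (k : ℕ) : Measurable (Y p k) := by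
  have h : Measurable fun b : Bool =>
      ((if b then (1 : ℝ) else -1) - pSubQ p k) / (2 * √(pq p k)) := measurable_of_finite _
  exact h.comp (measurable_pi_apply k)

lemma abs_Y_le (p : SuccessProb) (k : ℕ) (ω : Omega) :
    |Y p k ω| ≤ (1 + |pSubQ p k|) / (2 * √(pq p k)) := by
  have h : (0 : ℝ) ≤ 2 * √(pq p k) := by positivity
  rw [Y, abs_div, abs_of_nonneg h]
  gcongr
  refine (abs_sub _ _).trans ?_
  gcongr
  unfold X
  split_ifs <;> simp

/-- The monomial `Y_{i_1} ⋯ Y_{i_n}`. -/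
def monomial (p : SuccessProb) {n : ℕ} (i : Fin n → ℕ) (ω : Omega) : ℝ :=
  ∏ j, Y p (i j) ω

lemma memLp_monomial (p : SuccessProb) {n : ℕ} (i : Fin n → ℕ) :
    MemLp (monomial p i) 2 (P p) := by
  refine MemLp.of_bound (Measurable.aestronglyMeasurable ?_)
    (∏ j, (1 + |pSubQ p (i j)|) / (2 * √(pq p (i j)))) (Filter.Eventually.of_forall fun ω => ?_)
  · exact Finset.measurable_prod _ fun j _ => measurable_Y p (i j)
  · rw [monomial, Real.norm_eq_abs, Finset.abs_prod]
    exact Finset.prod_le_prod (fun _ _ => abs_nonneg _) fun j _ => abs_Y_le p (i j) ω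

/-- The space `L²(Ω)`. -/
abbrev L2 (p : SuccessProb) : Type := Lp ℝ 2 (P p)

/-- The discrete multiple stochastic integral
`J_n(f) = ∑_{(i_1,…,i_n) ∈ ℕⁿ} f(i_1,…,i_n) Y_{i_1} ⋯ Y_{i_n}`, the series being taken in `L²(Ω)`.
For `n = 0` this is the constant `f`. -/
def J (p : SuccessProb) {n : ℕ} (f : (Fin n → ℕ) → ℝ) : L2 p :=
  ∑' i : Fin n → ℕ, f i • (memLp_monomial p i).toLp (monomial p i)

/-- Symmetric square-summable kernels of order `n` that vanish on diagonals. -/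
structure IsKernel {n : ℕ} (f : (Fin n → ℕ) → ℝ) : Prop where
  symm : ∀ (σ : Equiv.Perm (Fin n)) (i : Fin n → ℕ), f (i ∘ σ) = f i
  diag : ∀ i : Fin n → ℕ, ¬ Function.Injective i → f i = 0
  summable : Summable fun i => f i ^ 2

/-- The chaos decomposition `F = E[F] + ∑_{n ≥ 1} J_n(f_n)` of a square-integrable `F`, with the
convention that the kernel of order zero is the constant `f_0 = E[F]`. -/
structure IsChaosDecomposition (p : SuccessProb) (F : Omega → ℝ)
    (f : (n : ℕ) → (Fin n → ℕ) → ℝ) : Prop where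
  kernel : ∀ n, IsKernel (f n)
  zero : ∀ i, f 0 i = ∫ ω, F ω ∂(P p)
  hasSum : ∃ G : L2 p, F =ᵐ[P p] G ∧ HasSum (fun n => J p (f n)) G

/-- The kernels `(f_n)` of the chaos decomposition of `F`. Every `F ∈ L²(Ω)` has a chaos
decomposition, and it is unique. -/
def chaosKernel (p : SuccessProb) (F : Omega → ℝ) : (n : ℕ) → (Fin n → ℕ) → ℝ :=
  Classical.epsilon (IsChaosDecomposition p F)

/-- `D_k F = √(p_k q_k) (F_k^+ - F_k^-)`. -/
def D (p : SuccessProb) (k : ℕ) (F : Omega → ℝ) (ω : Omega) : ℝ :=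
  √(pq p k) * (F (Function.update ω k true) - F (Function.update ω k false))

/-- `F ∈ dom(D)`: `F ∈ L²(Ω)` and `∑_{n ≥ 1} n n! ‖f_n‖² < ∞`. -/
def DomD (p : SuccessProb) (F : Omega → ℝ) : Prop :=
  MemLp F 2 (P p) ∧
    ∑' n : ℕ, ((n * n.factorial : ℕ) : ℝ≥0∞) *
      ∑' i : Fin n → ℕ, ENNReal.ofReal (chaosKernel p F n i ^ 2) < ∞

/-- The pseudo-inverse `L⁻¹ F = - ∑_{n ≥ 1} (1/n) J_n(f_n)` of the Ornstein–Uhlenbeck operator, for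
centred `F ∈ L²(Ω)`; the series is taken in `L²(Ω)`. -/
def LInv (p : SuccessProb) (F : Omega → ℝ) : L2 p :=
  -∑' n : ℕ, (1 / ((n : ℝ) + 1)) • J p (chaosKernel p F (n + 1))

/-- `- D_k L⁻¹ F`. -/
def negDLInv (p : SuccessProb) (k : ℕ) (F : Omega → ℝ) (ω : Omega) : ℝ :=
  -D p k (LInv p F) ω

/-- The iterated partial derivative of `g` along a list of coordinates. -/
def iterPartial {d : ℕ} (g : (Fin d → ℝ) → ℝ) : List (Fin d) → (Fin d → ℝ) → ℝ
  | [] => g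
  | i :: l => fun x => lineDeriv ℝ (iterPartial g l) x (Pi.single i 1)

/-- `g` is `n` times partially differentiable: all iterated partial derivatives of order at most
`n` exist at every point. -/
def PartiallyDifferentiable {d : ℕ} (n : ℕ) (g : (Fin d → ℝ) → ℝ) : Prop :=
  ∀ l : List (Fin d), l.length < n → ∀ (i : Fin d) (x : Fin d → ℝ),
    LineDifferentiableAt ℝ (iterPartial g l) x (Pi.single i 1)

/-- `M_k(g)`, the maximum over all partial derivatives of order `k` of their supremum norm. -/
def M {d : ℕ} (k : ℕ) (g : (Fin d → ℝ) → ℝ) : ℝ≥0∞ :=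
  ⨆ i : Fin k → Fin d, ⨆ x : Fin d → ℝ, ENNReal.ofReal |iterPartial g (List.ofFn i) x|

/-- The test functions of the `d₄`-distance. -/
def TestFun (d : ℕ) : Set ((Fin d → ℝ) → ℝ) :=
  {g | PartiallyDifferentiable 4 g ∧ M 1 g ≤ 1 ∧ M 2 g ≤ 1 ∧ M 3 g ≤ 1 ∧ M 4 g ≤ 1}

/-- The `d₄`-distance between (the laws of) two random vectors, as an element of `[0,∞]`. -/
def d4 {d : ℕ} {Ω₁ Ω₂ : Type*} [MeasurableSpace Ω₁] [MeasurableSpace Ω₂]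
    (U : Ω₁ → Fin d → ℝ) (μ₁ : Measure Ω₁) (V : Ω₂ → Fin d → ℝ) (μ₂ : Measure Ω₂) : ℝ≥0∞ :=
  ⨆ g ∈ TestFun d, ENNReal.ofReal |(∫ ω, g (U ω) ∂μ₁) - ∫ ω, g (V ω) ∂μ₂|

/-- `A₁ = ½ ∑_{i,j} E|Σ_{ij} - ⟨DF_j, -DL⁻¹F_i⟩|`. -/
def A1 (p : SuccessProb) {d : ℕ} (F : Fin d → Omega → ℝ) (S : Matrix (Fin d) (Fin d) ℝ) : ℝ≥0∞ :=
  (1 / 2) * ∑ i, ∑ j, ∫⁻ ω, ENNReal.ofReal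
    |S i j - ∑' k, D p k (F j) ω * negDLInv p k (F i) ω| ∂(P p)

/-- `A₂ = ¼ E⟨|p-q|/√(pq) (∑_j |DF_j|)², ∑_i |-DL⁻¹F_i|⟩`. -/
def A2 (p : SuccessProb) {d : ℕ} (F : Fin d → Omega → ℝ) : ℝ≥0∞ :=
  (1 / 4) * ∫⁻ ω, ∑' k, ENNReal.ofReal
    (|pSubQ p k| / √(pq p k) * (∑ j, |D p k (F j) ω|) ^ 2 * ∑ i, |negDLInv p k (F i) ω|) ∂(P p)

/-- `A₃ = (5/24) E⟨1/(pq) (∑_j |DF_j|)³, ∑_i |-DL⁻¹F_i|⟩`. -/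
def A3 (p : SuccessProb) {d : ℕ} (F : Fin d → Omega → ℝ) : ℝ≥0∞ :=
  (5 / 24) * ∫⁻ ω, ∑' k, ENNReal.ofReal
    (1 / pq p k * (∑ j, |D p k (F j) ω|) ^ 3 * ∑ i, |negDLInv p k (F i) ω|) ∂(P p)

end Rademacher

end

noncomputable section

namespace Rademacher

lemma pq_pos (p : SuccessProb) (k : ℕ) : 0 < pq p k :=
  mul_pos (p k).2.1 (sub_pos.2 (p k).2.2)

lemma measurable_update_const (k : ℕ) (b : Bool) :
    Measurable fun ω : Omega => Function.update ω k b :=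
  measurable_pi_iff.2 fun i => by
    by_cases h : i = k
    · subst h; simp
    · simpa [h] using measurable_pi_apply i

/-- Resampling of the `k`-th coordinate. -/
theorem resample (p : SuccessProb) (k : ℕ) :
    ENNReal.ofReal (p k) • (P p).map (fun ω => Function.update ω k true) +
      ENNReal.ofReal (1 - p k) • (P p).map (fun ω => Function.update ω k false) = P p := by
  refine Measure.eq_infinitePi _ fun s t ht => ?_
  have hpre : ∀ b : Bool, (P p).map (fun ω => Function.update ω k b) ((s : Set ℕ).pi t) =
      if k ∈ s then (t k).indicator 1 b * ∏ i ∈ s.erase k, coordMeasure (p i) (t i)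
        else ∏ i ∈ s, coordMeasure (p i) (t i) := by
    intro b
    rw [Measure.map_apply (measurable_update_const k b)
      (MeasurableSet.pi s.countable_toSet fun i _ => ht i)]
    by_cases hk : k ∈ s
    · by_cases hb : b ∈ t k
      · have : (fun ω : Omega => Function.update ω k b) ⁻¹' ((s : Set ℕ).pi t) =
            ((s.erase k : Finset ℕ) : Set ℕ).pi t := by
          ext ω
          simp only [Set.mem_preimage, Set.mem_pi, Finset.mem_coe, Finset.mem_erase]
          refine ⟨fun h i hi => by simpa [hi.1] using h i hi.2, fun h i hi => ?_⟩
          by_cases hik : i = k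
          · subst hik; simpa using hb
          · simpa [hik] using h i ⟨hik, hi⟩
        rw [this, Measure.infinitePi_pi _ fun i _ => ht i]
        simp [hk, hb]
      · have : (fun ω : Omega => Function.update ω k b) ⁻¹' ((s : Set ℕ).pi t) = ∅ := by
          ext ω
          simp only [Set.mem_preimage, Set.mem_pi, Finset.mem_coe, Set.mem_empty_iff_false,
            iff_false]
          intro h
          exact hb (by simpa using h k hk)
        rw [this]
        simp [hk, hb]
    · have : (fun ω : Omega => Function.update ω k b) ⁻¹' ((s : Set ℕ).pi t) =
            (s : Set ℕ).pi t := by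
          ext ω
          simp only [Set.mem_preimage, Set.mem_pi, Finset.mem_coe]
          refine forall₂_congr fun i hi => ?_
          have : i ≠ k := by rintro rfl; exact hk hi
          simp [this]
      rw [this, Measure.infinitePi_pi _ fun i _ => ht i]
      simp [hk]
  have hcoord : coordMeasure (p k) (t k) = ENNReal.ofReal (p k) * (t k).indicator 1 true +
      ENNReal.ofReal (1 - p k) * (t k).indicator 1 false := by
    simp [coordMeasure, Measure.dirac_apply' _ (ht k)]
  simp only [Measure.coe_add, Measure.coe_smul, Pi.add_apply, Pi.smul_apply, smul_eq_mul, hpre]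
  by_cases hk : k ∈ s
  · simp only [hk, if_true]
    rw [← Finset.mul_prod_erase s _ hk, hcoord]
    ring
  · simp only [hk, if_false]
    rw [← add_mul, ← ENNReal.ofReal_add (p k).2.1.le (sub_nonneg.2 (p k).2.2.le)]
    simp

/-- The probability of the value `b` at coordinate `k`. -/
def coordProb (p : SuccessProb) (k : ℕ) (b : Bool) : ℝ := if b then p k else 1 - p k

lemma coordProb_pos (p : SuccessProb) (k : ℕ) (b : Bool) : 0 < coordProb p k b := by
  cases b
  · simpa [coordProb] using (p k).2.2
  · simpa [coordProb] using (p k).2.1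

lemma map_update_le (p : SuccessProb) (k : ℕ) (b : Bool) :
    (P p).map (fun ω => Function.update ω k b) ≤
      ENNReal.ofReal (coordProb p k b)⁻¹ • P p := by
  have h : ENNReal.ofReal (coordProb p k b) • (P p).map (fun ω => Function.update ω k b) ≤ P p := by
    conv_rhs => rw [← resample p k]
    cases b
    · exact Measure.le_add_left (by simp [coordProb])
    · exact Measure.le_add_right (by simp [coordProb])
  have hpos := coordProb_pos p k b
  calc (P p).map (fun ω => Function.update ω k b)
      = ENNReal.ofReal (coordProb p k b)⁻¹ •
        ENNReal.ofReal (coordProb p k b) • (P p).map (fun ω => Function.update ω k b) := by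
        rw [smul_smul, ← ENNReal.ofReal_mul (inv_nonneg.2 hpos.le), inv_mul_cancel₀ hpos.ne']
        simp
    _ ≤ _ := by gcongr

lemma MemLp.comp_update {p : SuccessProb} {F : Omega → ℝ} {r : ℝ≥0∞} (hF : MemLp F r (P p))
    (k : ℕ) (b : Bool) : MemLp (fun ω => F (Function.update ω k b)) r (P p) := by
  have h1 : MemLp F r ((P p).map (fun ω => Function.update ω k b)) :=
    (hF.smul_measure ENNReal.ofReal_ne_top).mono_measure (map_update_le p k b)
  exact h1.comp_of_map (measurable_update_const k b).aemeasurable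

lemma integrable_comp_update {p : SuccessProb} {F : Omega → ℝ} (hF : Integrable F (P p))
    (k : ℕ) (b : Bool) : Integrable (fun ω => F (Function.update ω k b)) (P p) :=
  memLp_one_iff_integrable.1 (MemLp.comp_update (memLp_one_iff_integrable.2 hF) k b)

theorem integral_resample {p : SuccessProb} {F : Omega → ℝ} (hF : Integrable F (P p)) (k : ℕ) :
    ∫ ω, F ω ∂(P p) = p k * ∫ ω, F (Function.update ω k true) ∂(P p) +
      (1 - p k) * ∫ ω, F (Function.update ω k false) ∂(P p) := by
  have hi : ∀ b, Integrable F ((P p).map (fun ω => Function.update ω k b)) := fun b =>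
    (hF.smul_measure ENNReal.ofReal_ne_top).mono_measure (map_update_le p k b)
  conv_lhs => rw [← resample p k]
  rw [integral_add_measure ((hi _).smul_measure ENNReal.ofReal_ne_top)
    ((hi _).smul_measure ENNReal.ofReal_ne_top), integral_smul_measure, integral_smul_measure,
    integral_map (measurable_update_const k _).aemeasurable (hi _).aestronglyMeasurable,
    integral_map (measurable_update_const k _).aemeasurable (hi _).aestronglyMeasurable,
    ENNReal.toReal_ofReal (p k).2.1.le, ENNReal.toReal_ofReal (sub_nonneg.2 (p k).2.2.le)]
  simp

lemma Y_update_self (p : SuccessProb) (k : ℕ) (b : Bool) (ω : Omega) :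
    Y p k (Function.update ω k b) = if b then (1 - p k) / √(pq p k) else - (p k / √(pq p k)) := by
  have := (Real.sqrt_pos.2 (pq_pos p k)).ne'
  cases b <;> simp [Y, X, pSubQ] <;> field_simp <;> ring

lemma Y_update_ne (p : SuccessProb) {k l : ℕ} (h : l ≠ k) (b : Bool) (ω : Omega) :
    Y p l (Function.update ω k b) = Y p l ω := by
  simp [Y, X, h]

/-- Integrating against `Y_k` is integrating `D_k`. -/
theorem integral_Y_mul {p : SuccessProb} {F : Omega → ℝ} (k : ℕ) (hF : Integrable F (P p)) :
    ∫ ω, Y p k ω * F ω ∂(P p) = ∫ ω, D p k F ω ∂(P p) := by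
  have hYF : Integrable (fun ω => Y p k ω * F ω) (P p) :=
    hF.bdd_mul (measurable_Y p k).aestronglyMeasurable
      (Filter.Eventually.of_forall fun ω => abs_Y_le p k ω)
  rw [integral_resample hYF k]
  simp only [Y_update_self, if_true, D, integral_const_mul, Bool.false_eq_true, if_false]
  rw [integral_sub (integrable_comp_update hF k _) (integrable_comp_update hF k _)]
  have h := Real.sq_sqrt (pq_pos p k).le
  have h0 := (Real.sqrt_pos.2 (pq_pos p k)).ne'
  field_simp
  rw [h, pq]
  ring

/-- Integrating against `X_k` a function that does not depend on the `k`-th coordinate. -/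
theorem integral_X_mul {p : SuccessProb} {F : Omega → ℝ} (k : ℕ) (hF : Integrable F (P p))
    (hk : ∀ b ω, F (Function.update ω k b) = F ω) :
    ∫ ω, X k ω * F ω ∂(P p) = pSubQ p k * ∫ ω, F ω ∂(P p) := by
  have hX : Measurable (X k) :=
    (measurable_of_finite fun b : Bool => if b then (1 : ℝ) else -1).comp (measurable_pi_apply k)
  have hXF : Integrable (fun ω => X k ω * F ω) (P p) :=
    hF.bdd_mul (c := 1) hX.aestronglyMeasurable
      (Filter.Eventually.of_forall fun ω => by unfold X; split_ifs <;> simp)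
  rw [integral_resample hXF k]
  simp only [X, hk, Function.update_self, if_true, Bool.false_eq_true, if_false,
    integral_const_mul, pSubQ]
  ring

lemma D_update (p : SuccessProb) (k : ℕ) (F : Omega → ℝ) (ω : Omega) (b : Bool) :
    D p k F (Function.update ω k b) = D p k F ω := by
  simp [D]

lemma memLp_D {p : SuccessProb} {F : Omega → ℝ} {r : ℝ≥0∞} (hF : MemLp F r (P p)) (k : ℕ) :
    MemLp (D p k F) r (P p) :=
  ((MemLp.comp_update hF k true).sub (MemLp.comp_update hF k false)).const_mul _

end Rademacher

namespace Rademacher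

/-- The Walsh function `∏_{k ∈ A} Y_k`. -/
def walsh (p : SuccessProb) (A : Finset ℕ) (ω : Omega) : ℝ := ∏ k ∈ A, Y p k ω

lemma measurable_walsh (p : SuccessProb) (A : Finset ℕ) : Measurable (walsh p A) :=
  Finset.measurable_prod _ fun k _ => measurable_Y p k

lemma exists_abs_walsh_le (p : SuccessProb) (A : Finset ℕ) : ∃ C, ∀ ω, ‖walsh p A ω‖ ≤ C := by
  refine ⟨∏ k ∈ A, (1 + |pSubQ p k|) / (2 * √(pq p k)), fun ω => ?_⟩
  rw [walsh, Real.norm_eq_abs, Finset.abs_prod]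
  exact Finset.prod_le_prod (fun _ _ => abs_nonneg _) fun k _ => abs_Y_le p k ω

lemma memLp_walsh (p : SuccessProb) (A : Finset ℕ) (r : ℝ≥0∞) : MemLp (walsh p A) r (P p) := by
  obtain ⟨C, hC⟩ := exists_abs_walsh_le p A
  exact MemLp.of_bound (measurable_walsh p A).aestronglyMeasurable C
    (Filter.Eventually.of_forall hC)

lemma integrable_walsh (p : SuccessProb) (A : Finset ℕ) : Integrable (walsh p A) (P p) :=
  memLp_one_iff_integrable.1 (memLp_walsh p A 1)

lemma integrable_walsh_mul {p : SuccessProb} (A : Finset ℕ) {F : Omega → ℝ}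
    (hF : Integrable F (P p)) : Integrable (fun ω => walsh p A ω * F ω) (P p) := by
  obtain ⟨C, hC⟩ := exists_abs_walsh_le p A
  exact hF.bdd_mul (measurable_walsh p A).aestronglyMeasurable (Filter.Eventually.of_forall hC)

lemma walsh_update (p : SuccessProb) {A : Finset ℕ} {k : ℕ} (hk : k ∉ A) (b : Bool) (ω : Omega) :
    walsh p A (Function.update ω k b) = walsh p A ω :=
  Finset.prod_congr rfl fun l hl => Y_update_ne p (by rintro rfl; exact hk hl) b ω

lemma walsh_insert (p : SuccessProb) {A : Finset ℕ} {k : ℕ} (hk : k ∉ A) (ω : Omega) :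
    walsh p (insert k A) ω = Y p k ω * walsh p A ω := by
  simp [walsh, Finset.prod_insert hk]

/-- The Walsh coefficients of a function. -/
def coef (p : SuccessProb) (F : Omega → ℝ) (A : Finset ℕ) : ℝ := ∫ ω, walsh p A ω * F ω ∂(P p)

lemma coef_congr_ae {p : SuccessProb} {F G : Omega → ℝ} (h : F =ᵐ[P p] G) (A : Finset ℕ) :
    coef p F A = coef p G A :=
  integral_congr_ae (h.mono fun ω hω => by simp only [hω])

lemma coef_insert {p : SuccessProb} {F : Omega → ℝ} (hF : Integrable F (P p)) {A : Finset ℕ}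
    {k : ℕ} (hk : k ∉ A) : coef p F (insert k A) = coef p (D p k F) A := by
  have h := integral_Y_mul k (integrable_walsh_mul A hF)
  simp only [coef, walsh_insert p hk, mul_assoc]
  rw [h]
  refine integral_congr_ae (Filter.Eventually.of_forall fun ω => ?_)
  simp only [D, walsh_update p hk]
  ring

lemma D_D (p : SuccessProb) (k : ℕ) (F : Omega → ℝ) : D p k (D p k F) = 0 := by
  funext ω
  simp [D]

lemma integrable_D {p : SuccessProb} {F : Omega → ℝ} (hF : Integrable F (P p)) (k : ℕ) :
    Integrable (D p k F) (P p) :=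
  memLp_one_iff_integrable.1 (memLp_D (memLp_one_iff_integrable.2 hF) k)

lemma coef_D {p : SuccessProb} {F : Omega → ℝ} (hF : Integrable F (P p)) (A : Finset ℕ) (k : ℕ) :
    coef p (D p k F) A = if k ∈ A then 0 else coef p F (insert k A) := by
  split_ifs with hk
  · rw [← Finset.insert_erase hk, coef_insert (integrable_D hF k) (Finset.notMem_erase k A), D_D]
    simp [coef]
  · exact (coef_insert hF hk).symm

lemma D_walsh (p : SuccessProb) (A : Finset ℕ) (k : ℕ) :
    D p k (walsh p A) = if k ∈ A then walsh p (A.erase k) else 0 := by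
  funext ω
  split_ifs with hk
  · have h := Finset.notMem_erase k A
    conv_lhs => rw [← Finset.insert_erase hk]
    simp only [D, walsh_insert p h, walsh_update p h, Y_update_self]
    have h0 := (Real.sqrt_pos.2 (pq_pos p k)).ne'
    simp only [if_true, Bool.false_eq_true, if_false]
    field_simp
    ring
  · simp [D, walsh_update p hk]

lemma coef_walsh (p : SuccessProb) (A : Finset ℕ) :
    ∀ B : Finset ℕ, coef p (walsh p B) A = if A = B then 1 else 0 := by
  induction A using Finset.induction with
  | empty =>
    intro B
    rcases B.eq_empty_or_nonempty with rfl | ⟨k, hk⟩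
    · simp [coef, walsh]
    · have h1 : (∅ : Finset ℕ) ≠ B := by rintro rfl; simp at hk
      have h2 := coef_insert (p := p) (integrable_walsh p ∅) (Finset.notMem_erase k B)
      rw [Finset.insert_erase hk, D_walsh] at h2
      have h3 : coef p (walsh p B) ∅ = coef p (walsh p ∅) B := by simp [coef, mul_comm]
      rw [if_neg h1, h3, h2]
      simp [coef]
  | insert k A hk ih =>
    intro B
    rw [coef_insert (integrable_walsh p B) hk, D_walsh]
    by_cases hkB : k ∈ B
    · rw [if_pos hkB, ih]
      congr 1
      simp only [eq_iff_iff]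
      exact ⟨fun h => by rw [h, Finset.insert_erase hkB],
        fun h => by rw [← h, Finset.erase_insert hk]⟩
    · rw [if_neg hkB, if_neg (by rintro rfl; simp at hkB)]
      simp [coef]

/-- The Walsh functions as elements of `L²`. -/
def walshL2 (p : SuccessProb) (A : Finset ℕ) : L2 p := (memLp_walsh p A 2).toLp _

lemma inner_walshL2 (p : SuccessProb) (A : Finset ℕ) (G : L2 p) :
    inner ℝ (walshL2 p A) G = coef p G A := by
  rw [L2.inner_def, coef]
  refine integral_congr_ae ?_
  filter_upwards [(memLp_walsh p A 2).coeFn_toLp] with ω hω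
  simp [walshL2, hω, mul_comm]

lemma orthonormal_walshL2 (p : SuccessProb) : Orthonormal ℝ (walshL2 p) := by
  rw [orthonormal_iff_ite]
  intro A B
  rw [inner_walshL2, walshL2, coef_congr_ae (memLp_walsh p B 2).coeFn_toLp, coef_walsh]

lemma bool_affine (p : SuccessProb) (k : ℕ) (φ : Bool → ℝ) :
    ∃ a b : ℝ, ∀ ω : Omega, φ (ω k) = a * Y p k ω + b := by
  have h0 := (Real.sqrt_pos.2 (pq_pos p k)).ne'
  refine ⟨(φ true - φ false) * √(pq p k),
    (φ true + φ false) / 2 + (φ true - φ false) * pSubQ p k / 2, fun ω => ?_⟩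
  cases h : ω k <;> simp [Y, X, h] <;> field_simp <;> ring

theorem ae_eq_zero_of_coef_eq_zero {p : SuccessProb} {F : Omega → ℝ} (hF : Integrable F (P p))
    (h : ∀ A, coef p F A = 0) : F =ᵐ[P p] 0 := by
  have hcyl : ∀ (s : Finset ℕ) (φ : ℕ → Bool → ℝ),
      ∫ ω, (∏ k ∈ s, φ k (ω k)) * F ω ∂(P p) = 0 := by
    intro s φ
    choose a b hab using fun k => bool_affine p k (φ k)
    have : ∀ ω : Omega, (∏ k ∈ s, φ k (ω k)) * F ω =
        ∑ A ∈ s.powerset, ((∏ k ∈ A, a k) * ∏ k ∈ s \ A, b k) * (walsh p A ω * F ω) := by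
      intro ω
      simp only [hab, Finset.prod_add, Finset.sum_mul, Finset.prod_mul_distrib, walsh]
      exact Finset.sum_congr rfl fun A _ => by ring
    simp only [this]
    rw [integral_finsetSum _ fun A _ => (integrable_walsh_mul A hF).const_mul _]
    refine Finset.sum_eq_zero fun A _ => ?_
    rw [integral_const_mul]
    simp only [coef] at h
    rw [h, mul_zero]
  refine hF.ae_eq_zero_of_forall_setIntegral_eq_zero fun s hs _ => ?_
  induction s, hs using MeasurableSpace.induction_on_inter
    (generateFrom_squareCylinders (ι := ℕ) (α := fun _ => Bool)).symm
    (isPiSystem_squareCylinders (fun _ => MeasurableSpace.isPiSystem_measurableSet)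
      fun _ => MeasurableSet.univ (α := Bool)) with
  | empty => simp
  | basic S hS =>
    obtain ⟨s, t, ht, rfl⟩ := hS
    have hm : MeasurableSet ((s : Set ℕ).pi t) :=
      MeasurableSet.pi s.countable_toSet fun i _ => MeasurableSet.of_discrete
    rw [← integral_indicator hm, ← hcyl s fun k => (t k).indicator 1]
    refine integral_congr_ae (Filter.Eventually.of_forall fun ω => ?_)
    by_cases hω : ω ∈ (s : Set ℕ).pi t
    · simp only [Set.indicator_of_mem hω]
      rw [Finset.prod_eq_one fun k hk => ?_, one_mul]
      simp [Set.indicator_of_mem (hω k hk)]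
    · simp only [Set.indicator_of_notMem hω]
      simp only [Set.mem_pi, not_forall] at hω
      obtain ⟨k, hk, hkt⟩ := hω
      rw [Finset.prod_eq_zero hk (Set.indicator_of_notMem hkt _), zero_mul]
  | compl S hS ih =>
    have h1 := integral_add_compl hS hF
    have h3 := ih (measure_lt_top _ _)
    have h2 : ∫ ω, F ω ∂(P p) = 0 := by simpa using hcyl ∅ 0
    linarith
  | iUnion f hd hm ih =>
    rw [integral_iUnion hm hd hF.integrableOn]
    simp [ih]

/-- The Hilbert basis of Walsh functions. -/
def walshBasis (p : SuccessProb) : HilbertBasis (Finset ℕ) ℝ (L2 p) :=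
  HilbertBasis.mkOfOrthogonalEqBot (orthonormal_walshL2 p) <| by
    rw [Submodule.eq_bot_iff]
    intro G hG
    rw [Lp.eq_zero_iff_ae_eq_zero]
    refine ae_eq_zero_of_coef_eq_zero ((Lp.memLp G).integrable one_le_two) fun A => ?_
    rw [← inner_walshL2]
    exact (Submodule.mem_orthogonal _ _).1 hG _ (Submodule.subset_span ⟨A, rfl⟩)

@[simp] lemma walshBasis_apply (p : SuccessProb) (A : Finset ℕ) :
    walshBasis p A = walshL2 p A := by
  rw [walshBasis, HilbertBasis.coe_mkOfOrthogonalEqBot]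

/-- Parseval's identity. -/
theorem hasSum_coef_mul {p : SuccessProb} {F G : Omega → ℝ} (hF : MemLp F 2 (P p))
    (hG : MemLp G 2 (P p)) :
    HasSum (fun A => coef p F A * coef p G A) (∫ ω, F ω * G ω ∂(P p)) := by
  have h := (walshBasis p).hasSum_inner_mul_inner (hF.toLp F) (hG.toLp G)
  have h1 : inner ℝ (hF.toLp F) (hG.toLp G) = ∫ ω, F ω * G ω ∂(P p) := by
    rw [L2.inner_def]
    refine integral_congr_ae ?_
    filter_upwards [hF.coeFn_toLp, hG.coeFn_toLp] with ω h1 h2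
    simp [h1, h2, mul_comm]
  rw [h1] at h
  refine h.congr_fun fun A => ?_
  rw [real_inner_comm, walshBasis_apply, inner_walshL2, inner_walshL2,
    coef_congr_ae hF.coeFn_toLp, coef_congr_ae hG.coeFn_toLp]

lemma L2_ext_coef {p : SuccessProb} {F G : L2 p} (h : ∀ A, coef p F A = coef p G A) : F = G := by
  refine (walshBasis p).repr.injective (lp.ext (funext fun A => ?_))
  rw [HilbertBasis.repr_apply_apply, HilbertBasis.repr_apply_apply, walshBasis_apply,
    inner_walshL2, inner_walshL2, h]

end Rademacher

namespace Rademacher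

lemma coef_hasSum {p : SuccessProb} {ι : Type*} {x : ι → L2 p} {G : L2 p} (h : HasSum x G)
    (A : Finset ℕ) : HasSum (fun i => coef p (x i) A) (coef p G A) := by
  simpa [inner_walshL2] using (innerSL ℝ (walshL2 p A)).hasSum h

lemma coef_smul_L2 {p : SuccessProb} (c : ℝ) (G : L2 p) (A : Finset ℕ) :
    coef p (c • G : L2 p) A = c * coef p G A := by
  rw [← inner_walshL2, inner_smul_right, inner_walshL2]

lemma coef_walshL2 (p : SuccessProb) (A B : Finset ℕ) :
    coef p (walshL2 p B) A = if A = B then 1 else 0 := by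
  rw [walshL2, coef_congr_ae (memLp_walsh p B 2).coeFn_toLp, coef_walsh]

lemma summable_smul_orthonormal {H ι : Type*} [NormedAddCommGroup H] [InnerProductSpace ℝ H]
    [CompleteSpace H] {v : ι → H} (hv : Orthonormal ℝ v) {c : ι → ℝ}
    (hc : Summable fun i => c i ^ 2) : Summable fun i => c i • v i := by
  have := (hv.orthogonalFamily.summable_iff_norm_sq_summable c).2 (by simpa using hc)
  simpa using this

/-- A square-summable family of coefficients can be summed degree by degree. -/
theorem hasSum_of_coef {p : SuccessProb} {c : Finset ℕ → ℝ} (hc : Summable fun A => c A ^ 2)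
    {g : ℕ → L2 p} (hg : ∀ n A, coef p (g n) A = if A.card = n then c A else 0) :
    ∃ G : L2 p, (∀ A, coef p G A = c A) ∧ HasSum g G := by
  have hs := summable_smul_orthonormal (orthonormal_walshL2 p) hc
  refine ⟨∑' A, c A • walshL2 p A, fun A => ?_, ?_⟩
  · refine (coef_hasSum hs.hasSum A).unique ?_
    simp only [coef_smul_L2, coef_walshL2]
    convert hasSum_ite_eq A (c A) using 2 with B
    by_cases h : A = B
    · simp [h]
    · simp [h, Ne.symm h]
  · have h1 := (Equiv.sigmaFiberEquiv (Finset.card (α := ℕ))).hasSum_iff.2 hs.hasSum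
    refine h1.sigma fun n => ?_
    have h2 := (h1.summable.sigma_factor n).hasSum
    have h3 : (∑' A : {A : Finset ℕ // A.card = n}, ((fun A => c A • walshL2 p A) ∘
        Equiv.sigmaFiberEquiv (Finset.card (α := ℕ))) ⟨n, A⟩) = g n := by
      refine L2_ext_coef fun A => ?_
      have h4 := coef_hasSum h2 A
      refine h4.unique ?_
      rw [hg]
      simp only [Function.comp_apply, Equiv.sigmaFiberEquiv, Equiv.coe_fn_mk, coef_smul_L2,
        coef_walshL2]
      split_ifs with hA
      · convert hasSum_ite_eq (⟨A, hA⟩ : {A : Finset ℕ // A.card = n}) (c A) using 2 with B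
        by_cases h : A = B
        · subst h; simp
        · simp [h, Subtype.ext_iff, Ne.symm h]
      · convert hasSum_zero using 2 with B
        rw [if_neg, mul_zero]
        rintro rfl
        exact hA B.2
    exact h3 ▸ h2

/-- The set of values of a multi-index. -/
def valueSet {n : ℕ} (i : Fin n → ℕ) : Finset ℕ := Finset.univ.image i

lemma card_valueSet {n : ℕ} {i : Fin n → ℕ} (hi : Function.Injective i) :
    (valueSet i).card = n := by
  simp [valueSet, Finset.card_image_of_injective _ hi]

lemma valueSet_comp_perm {n : ℕ} (i : Fin n → ℕ) (σ : Equiv.Perm (Fin n)) :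
    valueSet (i ∘ σ) = valueSet i := by
  ext k
  simp only [valueSet, Finset.mem_image, Finset.mem_univ, true_and, Function.comp_apply]
  exact (σ.surjective.exists (p := fun a => i a = k)).symm

lemma eq_of_sort_eq {n : ℕ} {i j : Fin n → ℕ} (hi : Function.Injective i)
    (hj : Function.Injective j) (h : valueSet i = valueSet j) (hs : Tuple.sort i = Tuple.sort j) :
    i = j := by
  have h1 : StrictMono (i ∘ Tuple.sort i) :=
    (Tuple.monotone_sort i).strictMono_of_injective (hi.comp (Equiv.injective _))
  have h2 : StrictMono (j ∘ Tuple.sort i) :=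
    hs ▸ (Tuple.monotone_sort j).strictMono_of_injective (hj.comp (Equiv.injective _))
  have h3 : i ∘ Tuple.sort i = j ∘ Tuple.sort i := by
    refine (StrictMono.range_inj h1 h2).1 ?_
    rw [Set.range_comp, Set.range_comp, (Equiv.surjective _).range_eq, Set.image_univ,
      Set.image_univ]
    simpa [valueSet] using congrArg (fun s : Finset ℕ => (s : Set ℕ)) h
  funext x
  simpa using congrFun h3 ((Tuple.sort i).symm x)

lemma summable_multiIndex {E : Type*} [AddCommMonoid E] [TopologicalSpace E] [ContinuousAdd E]
    {n : ℕ} {u : (Fin n → ℕ) → E} (h0 : ∀ i, ¬ Function.Injective i → u i = 0)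
    (h : ∀ S : Set (Fin n → ℕ), (∀ i ∈ S, Function.Injective i) → Set.InjOn valueSet S →
      Summable fun i : S => u i) : Summable u := by
  let S : Equiv.Perm (Fin n) → Set (Fin n → ℕ) := fun σ =>
    {i | Function.Injective i ∧ Tuple.sort i = σ}
  have h1 : u = fun i => ∑ σ, (S σ).indicator u i := by
    classical
    funext i
    by_cases hi : Function.Injective i
    · rw [Finset.sum_eq_single (Tuple.sort i)]
      · exact (Set.indicator_of_mem (show i ∈ S _ from ⟨hi, rfl⟩) u).symm
      · intro σ _ hσ
        exact Set.indicator_of_notMem (fun hm => hσ hm.2.symm) u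
      · simp
    · rw [h0 i hi]
      exact (Finset.sum_eq_zero fun σ _ => Set.indicator_of_notMem (fun hm => hi hm.1) u).symm
  rw [h1]
  refine summable_sum fun σ _ => ?_
  rw [← summable_subtype_iff_indicator]
  exact h (S σ) (fun i hi => hi.1) fun i hi j hj hij =>
    eq_of_sort_eq hi.1 hj.1 hij (hi.2.trans hj.2.symm)

/-- The injective enumerations of a finite set. -/
def enums (n : ℕ) (A : Finset ℕ) : Finset (Fin n → ℕ) :=
  (Fintype.piFinset fun _ => A).filter fun i => Function.Injective i ∧ valueSet i = A

lemma mem_enums {n : ℕ} {A : Finset ℕ} {i : Fin n → ℕ} :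
    i ∈ enums n A ↔ Function.Injective i ∧ valueSet i = A := by
  simp only [enums, Finset.mem_filter, Fintype.mem_piFinset, and_iff_right_iff_imp]
  rintro ⟨-, rfl⟩ a
  simp [valueSet]

lemma card_enums_le (n : ℕ) (A : Finset ℕ) : (enums n A).card ≤ n.factorial := by
  have := Finset.card_le_card_of_injOn (s := enums n A) (t := Finset.univ) Tuple.sort
    (fun _ _ => Finset.mem_coe.2 (Finset.mem_univ _)) fun i hi j hj hij => by
      have hi' := mem_enums.1 (Finset.mem_coe.1 hi)
      have hj' := mem_enums.1 (Finset.mem_coe.1 hj)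
      exact eq_of_sort_eq hi'.1 hj'.1 (hi'.2.trans hj'.2.symm) hij
  simpa [Fintype.card_perm] using this

lemma enums_nonempty (A : Finset ℕ) : (enums A.card A).Nonempty := by
  refine ⟨A.orderEmbOfFin rfl, mem_enums.2 ⟨(A.orderEmbOfFin rfl).injective, ?_⟩⟩
  exact A.image_orderEmbOfFin_univ rfl

lemma enums_eq_empty {n : ℕ} {A : Finset ℕ} (h : A.card ≠ n) : enums n A = ∅ := by
  refine Finset.eq_empty_of_forall_notMem fun i hi => h ?_
  obtain ⟨h1, rfl⟩ := mem_enums.1 hi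
  exact card_valueSet h1

lemma monomial_eq_walsh (p : SuccessProb) {n : ℕ} {i : Fin n → ℕ} (hi : Function.Injective i) :
    monomial p i = walsh p (valueSet i) := by
  funext ω
  rw [walsh, valueSet, Finset.prod_image fun a _ b _ h => hi h]
  rfl

lemma toLp_monomial (p : SuccessProb) {n : ℕ} {i : Fin n → ℕ} (hi : Function.Injective i) :
    (memLp_monomial p i).toLp (monomial p i) = walshL2 p (valueSet i) := by
  simp only [monomial_eq_walsh p hi, walshL2]

theorem summable_J (p : SuccessProb) {n : ℕ} {f : (Fin n → ℕ) → ℝ} (hf : IsKernel f) :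
    Summable fun i : Fin n → ℕ => f i • (memLp_monomial p i).toLp (monomial p i) := by
  refine summable_multiIndex (fun i hi => by rw [hf.diag i hi, zero_smul]) fun S hS hinj => ?_
  have h1 : Orthonormal ℝ fun i : S => walshL2 p (valueSet i.1) :=
    (orthonormal_walshL2 p).comp _ hinj.injective
  refine (summable_smul_orthonormal h1 (hf.summable.subtype S)).congr fun i => ?_
  rw [toLp_monomial p (hS i i.2)]

theorem coef_J (p : SuccessProb) {n : ℕ} {f : (Fin n → ℕ) → ℝ} (hf : IsKernel f) (A : Finset ℕ) :
    coef p (J p f) A = ∑ i ∈ enums n A, f i := by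
  refine (coef_hasSum (summable_J p hf).hasSum A).unique ?_
  have h1 : ∀ i : Fin n → ℕ, coef p (f i • (memLp_monomial p i).toLp (monomial p i) : L2 p) A =
      if i ∈ enums n A then f i else 0 := by
    intro i
    rw [coef_smul_L2]
    by_cases hi : Function.Injective i
    · rw [toLp_monomial p hi, coef_walshL2]
      simp [mem_enums, hi, eq_comm]
    · simp [hf.diag i hi]
  simp only [h1]
  have h2 := hasSum_sum_of_ne_finset_zero (f := fun i => if i ∈ enums n A then f i else 0)
    (s := enums n A) (L := .unconditional _) fun i hi => if_neg hi
  convert h2 using 1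
  exact Finset.sum_congr rfl fun i hi => (if_pos hi).symm

lemma summable_coef_sq {p : SuccessProb} {F : Omega → ℝ} (hF : MemLp F 2 (P p)) :
    Summable fun A => coef p F A ^ 2 := by
  simpa only [sq] using (hasSum_coef_mul hF hF).summable

/-- Every square-integrable function has a chaos decomposition. -/
theorem exists_isChaosDecomposition {p : SuccessProb} {F : Omega → ℝ} (hF : MemLp F 2 (P p)) :
    ∃ f, IsChaosDecomposition p F f := by
  classical
  let f : (n : ℕ) → (Fin n → ℕ) → ℝ := fun n i =>
    if Function.Injective i then coef p F (valueSet i) / (enums n (valueSet i)).card else 0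
  have hker : ∀ n, IsKernel (f n) := by
    intro n
    have hdiag : ∀ i : Fin n → ℕ, ¬ Function.Injective i → f n i = 0 := fun i hi => if_neg hi
    refine ⟨fun σ i => ?_, hdiag, ?_⟩
    · simp only [f, valueSet_comp_perm, σ.injective_comp]
    · refine summable_multiIndex (fun i hi => by simp [hdiag i hi]) fun S hS hinj => ?_
      refine Summable.of_nonneg_of_le (fun _ => sq_nonneg _) (fun i => ?_)
        ((summable_coef_sq hF).comp_injective hinj.injective)
      have h1 : (1 : ℝ) ≤ (enums n (valueSet i.1)).card := by
        exact_mod_cast Finset.card_pos.2 ⟨i.1, mem_enums.2 ⟨hS i i.2, rfl⟩⟩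
      simp only [f, if_pos (hS i i.2), Function.comp_apply, Set.domRestrict_apply, div_pow]
      exact div_le_self (sq_nonneg _) (one_le_pow₀ h1)
  have hcoef : ∀ n A, coef p (J p (f n)) A = if A.card = n then coef p F A else 0 := by
    intro n A
    rw [coef_J p (hker n)]
    split_ifs with hA
    · subst hA
      have h1 : ((enums A.card A).card : ℝ) ≠ 0 := by
        exact_mod_cast (Finset.card_pos.2 (enums_nonempty A)).ne'
      rw [Finset.sum_congr rfl (g := fun _ => coef p F A / (enums A.card A).card)]
      · simp only [Finset.sum_const, nsmul_eq_mul]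
        field_simp
      · intro i hi
        obtain ⟨h2, h3⟩ := mem_enums.1 hi
        simp only [f, if_pos h2, h3]
    · simp [enums_eq_empty hA]
  obtain ⟨G, hG, hs⟩ := hasSum_of_coef (summable_coef_sq hF) hcoef
  refine ⟨f, hker, fun i => ?_, G, ?_, hs⟩
  · have h1 : valueSet i = ∅ := by simp [valueSet]
    have h2 := hcoef 0 ∅
    rw [coef_J p (hker 0)] at h2
    have h3 : enums 0 ∅ = {i} := by
      ext j
      simp [mem_enums, valueSet, Subsingleton.elim j i, Function.injective_of_subsingleton]
    rw [h3] at h2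
    simpa [coef, walsh] using h2
  · have h1 : hF.toLp F = G := L2_ext_coef fun A => by
      rw [hG, coef_congr_ae hF.coeFn_toLp]
    rw [← h1]
    exact hF.coeFn_toLp.symm

theorem isChaosDecomposition_chaosKernel {p : SuccessProb} {F : Omega → ℝ}
    (hF : MemLp F 2 (P p)) : IsChaosDecomposition p F (chaosKernel p F) :=
  Classical.epsilon_spec (exists_isChaosDecomposition hF)

theorem coef_J_chaosKernel {p : SuccessProb} {F : Omega → ℝ} (hF : MemLp F 2 (P p)) (n : ℕ)
    (A : Finset ℕ) :
    coef p (J p (chaosKernel p F n)) A = if A.card = n then coef p F A else 0 := by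
  have h := isChaosDecomposition_chaosKernel hF
  obtain ⟨G, hG, hs⟩ := h.hasSum
  have h0 : ∀ n, A.card ≠ n → coef p (J p (chaosKernel p F n)) A = 0 := fun n hn => by
    simp [coef_J p (h.kernel n), enums_eq_empty hn]
  split_ifs with hA
  · subst hA
    rw [coef_congr_ae hG]
    exact (hasSum_single _ fun n hn => h0 n hn.symm).unique (coef_hasSum hs A)
  · exact h0 n hA

/-- The Walsh coefficients of `L⁻¹F`. -/
theorem coef_LInv {p : SuccessProb} {F : Omega → ℝ} (hF : MemLp F 2 (P p)) (A : Finset ℕ) :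
    coef p (LInv p F) A = -(coef p F A / A.card) := by
  let c : Finset ℕ → ℝ := fun A => coef p F A / A.card
  have hc : Summable fun A => c A ^ 2 := by
    refine Summable.of_nonneg_of_le (fun _ => sq_nonneg _) (fun A => ?_) (summable_coef_sq hF)
    rcases A.eq_empty_or_nonempty with rfl | hA
    · simp [c, sq_nonneg]
    · simp only [c, div_pow]
      exact div_le_self (sq_nonneg _) (one_le_pow₀ (by exact_mod_cast hA.card_pos))
  let g : ℕ → L2 p := fun n => (1 / (n : ℝ)) • J p (chaosKernel p F n)
  have hg : ∀ n A, coef p (g n) A = if A.card = n then c A else 0 := by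
    intro n A
    simp only [g, coef_smul_L2, coef_J_chaosKernel hF, c]
    split_ifs with h
    · rw [h]; ring
    · simp
  obtain ⟨G, hG, hs⟩ := hasSum_of_coef hc hg
  have h1 : ∑' n : ℕ, (1 / ((n : ℝ) + 1)) • J p (chaosKernel p F (n + 1)) = G := by
    have h2 := (hasSum_nat_add_iff' 1).2 hs
    simp only [Finset.range_one, Finset.sum_singleton, g, Nat.cast_zero, div_zero, zero_smul,
      sub_zero, Nat.cast_add, Nat.cast_one] at h2
    exact h2.tsum_eq
  have h3 : LInv p F = (-1 : ℝ) • G := by rw [LInv, h1, neg_one_smul]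
  rw [h3, coef_smul_L2, hG, neg_one_mul]

lemma tsum_enums_le {n : ℕ} (u : (Fin n → ℕ) → ℝ≥0∞) :
    ∑' A, ∑ i ∈ enums n A, u i ≤ ∑' i, u i := by
  have h1 : ∀ A, ∑ i ∈ enums n A, u i = ∑' i, if i ∈ enums n A then u i else 0 := by
    intro A
    rw [tsum_eq_sum (s := enums n A) fun i hi => if_neg hi]
    exact Finset.sum_congr rfl fun i hi => (if_pos hi).symm
  simp only [h1]
  rw [ENNReal.tsum_comm]
  refine ENNReal.tsum_le_tsum fun i => ?_
  rw [tsum_eq_single (valueSet i) fun A hA => if_neg fun h => hA (mem_enums.1 h).2.symm]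
  split_ifs <;> simp

/-- For `F ∈ dom(D)` the Walsh coefficients satisfy `∑_A |A| a_A² < ∞`. -/
theorem DomD.summable_card_mul_coef_sq {p : SuccessProb} {F : Omega → ℝ} (hF : DomD p F) :
    Summable fun A : Finset ℕ => (A.card : ℝ) * coef p F A ^ 2 := by
  have hker := (isChaosDecomposition_chaosKernel hF.1).kernel
  have hle : ∀ A : Finset ℕ, ENNReal.ofReal ((A.card : ℝ) * coef p F A ^ 2) ≤
      ((A.card * A.card.factorial : ℕ) : ℝ≥0∞) *
        ∑ i ∈ enums A.card A, ENNReal.ofReal (chaosKernel p F A.card i ^ 2) := by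
    intro A
    rw [← ENNReal.ofReal_sum_of_nonneg fun _ _ => sq_nonneg _, ← ENNReal.ofReal_natCast,
      ← ENNReal.ofReal_mul (Nat.cast_nonneg _)]
    refine ENNReal.ofReal_le_ofReal ?_
    have h1 := coef_J_chaosKernel hF.1 A.card A
    rw [if_pos rfl, coef_J p (hker _)] at h1
    rw [← h1, Nat.cast_mul, mul_assoc]
    refine mul_le_mul_of_nonneg_left ?_ (Nat.cast_nonneg _)
    refine sq_sum_le_card_mul_sum_sq.trans ?_
    refine mul_le_mul_of_nonneg_right ?_ (Finset.sum_nonneg fun _ _ => sq_nonneg _)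
    exact_mod_cast card_enums_le _ _
  have hfin : ∑' A : Finset ℕ, ENNReal.ofReal ((A.card : ℝ) * coef p F A ^ 2) < ∞ := by
    refine lt_of_le_of_lt ?_ hF.2
    calc ∑' A : Finset ℕ, ENNReal.ofReal ((A.card : ℝ) * coef p F A ^ 2)
        ≤ ∑' A : Finset ℕ, ∑' n : ℕ, ((n * n.factorial : ℕ) : ℝ≥0∞) *
            ∑ i ∈ enums n A, ENNReal.ofReal (chaosKernel p F n i ^ 2) :=
          ENNReal.tsum_le_tsum fun A => (hle A).trans (ENNReal.le_tsum (f := fun n : ℕ =>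
            ((n * n.factorial : ℕ) : ℝ≥0∞) *
              ∑ i ∈ enums n A, ENNReal.ofReal (chaosKernel p F n i ^ 2)) A.card)
      _ = ∑' n : ℕ, ((n * n.factorial : ℕ) : ℝ≥0∞) *
            ∑' A, ∑ i ∈ enums n A, ENNReal.ofReal (chaosKernel p F n i ^ 2) := by
          rw [ENNReal.tsum_comm]
          simp only [ENNReal.tsum_mul_left]
      _ ≤ _ := ENNReal.tsum_le_tsum fun n => by gcongr; exact tsum_enums_le _
  have h := ENNReal.summable_toReal hfin.ne
  refine h.congr fun A => ?_
  exact ENNReal.toReal_ofReal (by positivity)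

end Rademacher

namespace Rademacher

/-- Reindexing of a sum along `B ↦ B ∪ {k}`. -/
lemma hasSum_insert_iff (k : ℕ) (φ : Finset ℕ → ℝ) (s : ℝ) :
    HasSum (fun B => if k ∈ B then 0 else φ (insert k B)) s ↔
      HasSum (fun A => if k ∈ A then φ A else 0) s := by
  let e : Finset ℕ → Finset ℕ := fun B => if k ∈ B then B.erase k else insert k B
  have he : Function.Involutive e := by
    intro B
    by_cases h : k ∈ B
    · simp [e, h]
    · simp [e, h]
  have h : (fun B => if k ∈ B then 0 else φ (insert k B)) =
      (fun A => if k ∈ A then φ A else 0) ∘ he.toPerm := by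
    funext B
    by_cases h : k ∈ B <;> simp [e, h]
  rw [h, he.toPerm.hasSum_iff]

theorem hasSum_D_mul {p : SuccessProb} {F G : Omega → ℝ} (hF : MemLp F 2 (P p))
    (hG : MemLp G 2 (P p)) (k : ℕ) :
    HasSum (fun A => if k ∈ A then coef p F A * coef p G A else 0)
      (∫ ω, D p k F ω * D p k G ω ∂(P p)) := by
  rw [← hasSum_insert_iff k fun A => coef p F A * coef p G A]
  refine (hasSum_coef_mul (memLp_D hF k) (memLp_D hG k)).congr_fun fun A => ?_
  rw [coef_D (hF.integrable one_le_two), coef_D (hG.integrable one_le_two)]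
  split_ifs <;> simp

lemma hasSum_swap_mem {c : Finset ℕ → ℝ} {s : ℝ} (hc : HasSum c s) (h0 : c ∅ = 0) {t : ℕ → ℝ}
    (ht : ∀ k, HasSum (fun A => if k ∈ A then c A / A.card else 0) (t k)) : HasSum t s := by
  have hfib : ∀ (c : Finset ℕ → ℝ), c ∅ = 0 → ∀ A : Finset ℕ,
      HasSum (fun k => if k ∈ A then c A / A.card else 0) (c A) := by
    intro c h0 A
    have h1 := hasSum_sum_of_ne_finset_zero (f := fun k => if k ∈ A then c A / A.card else 0)
      (s := A) (L := .unconditional _) fun k hk => if_neg hk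
    convert h1 using 1
    rw [Finset.sum_congr rfl fun k hk => if_pos hk]
    rcases A.eq_empty_or_nonempty with rfl | hA
    · simp [h0]
    · have : (A.card : ℝ) ≠ 0 := by exact_mod_cast hA.card_pos.ne'
      simp only [Finset.sum_const, nsmul_eq_mul]
      field_simp
  have hs : Summable fun x : Finset ℕ × ℕ => if x.2 ∈ x.1 then c x.1 / x.1.card else 0 := by
    refine Summable.of_abs ((summable_prod_of_nonneg fun _ => abs_nonneg _).2 ⟨fun A => ?_, ?_⟩)
    · exact (hfib c h0 A).summable.abs
    · refine hc.summable.abs.congr fun A => ?_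
      have h2 := (hfib (fun A => |c A|) (by simp [h0]) A).tsum_eq
      rw [← h2]
      refine tsum_congr fun k => ?_
      split_ifs <;> simp [abs_div]
  have h1 : HasSum (fun x : Finset ℕ × ℕ => if x.2 ∈ x.1 then c x.1 / x.1.card else 0) s := by
    have := hs.hasSum.prod_fiberwise fun A => hfib c h0 A
    rw [hc.unique this]
    exact hs.hasSum
  have h2 := (Equiv.prodComm ℕ (Finset ℕ)).hasSum_iff.2 h1
  exact h2.prod_fiberwise fun k => ht k

lemma memLp_negDLInv (p : SuccessProb) (k : ℕ) (F : Omega → ℝ) :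
    MemLp (negDLInv p k F) 2 (P p) :=
  (memLp_D (Lp.memLp (LInv p F)) k).neg

lemma negDLInv_update (p : SuccessProb) (k : ℕ) (F : Omega → ℝ) (ω : Omega) (b : Bool) :
    negDLInv p k F (Function.update ω k b) = negDLInv p k F ω := by
  simp [negDLInv, D_update]

/-- The integration by parts formula `E[G F] = E⟨DG, -DL⁻¹F⟩` for centred `F`. -/
theorem integration_by_parts {p : SuccessProb} {F G : Omega → ℝ} (hF : MemLp F 2 (P p))
    (hF0 : ∫ ω, F ω ∂(P p) = 0) (hG : MemLp G 2 (P p)) :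
    HasSum (fun k => ∫ ω, D p k G ω * negDLInv p k F ω ∂(P p)) (∫ ω, G ω * F ω ∂(P p)) := by
  refine hasSum_swap_mem (hasSum_coef_mul hG hF) (by simp [coef, walsh, hF0]) fun k => ?_
  have h := (hasSum_D_mul hG (Lp.memLp (LInv p F)) k).neg
  rw [← integral_neg] at h
  simp only [negDLInv, mul_neg]
  refine h.congr_fun fun A => ?_
  rw [coef_LInv hF]
  split_ifs <;> simp [mul_div_assoc]

theorem DomD.summable_integral_D_sq {p : SuccessProb} {F : Omega → ℝ} (hF : DomD p F) :
    Summable fun k => ∫ ω, D p k F ω ^ 2 ∂(P p) := by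
  refine (hasSum_swap_mem hF.summable_card_mul_coef_sq.hasSum (by simp) fun k => ?_).summable
  have h := hasSum_D_mul hF.1 hF.1 k
  simp only [← sq] at h
  refine h.congr_fun fun A => ?_
  split_ifs with hk
  · have : (A.card : ℝ) ≠ 0 := by exact_mod_cast (Finset.card_pos.2 ⟨k, hk⟩).ne'
    field_simp
  · rfl

theorem summable_integral_negDLInv_sq {p : SuccessProb} {F : Omega → ℝ} (hF : MemLp F 2 (P p)) :
    Summable fun k => ∫ ω, negDLInv p k F ω ^ 2 ∂(P p) := by
  have hc : Summable fun A : Finset ℕ => coef p F A ^ 2 / A.card := by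
    refine Summable.of_nonneg_of_le (fun _ => by positivity) (fun A => ?_) (summable_coef_sq hF)
    rcases A.eq_empty_or_nonempty with rfl | hA
    · simp [sq_nonneg]
    · exact div_le_self (sq_nonneg _) (by exact_mod_cast hA.card_pos)
  refine (hasSum_swap_mem hc.hasSum (by simp) fun k => ?_).summable
  have h := hasSum_D_mul (Lp.memLp (LInv p F)) (Lp.memLp (LInv p F)) k
  simp only [← sq] at h
  simp only [negDLInv, neg_sq]
  refine h.congr_fun fun A => ?_
  rw [coef_LInv hF]
  split_ifs with hk
  · ring
  · rfl

lemma integrable_D_mul_negDLInv {p : SuccessProb} {F G : Omega → ℝ} (hG : MemLp G 2 (P p))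
    (k : ℕ) : Integrable (fun ω => D p k G ω * negDLInv p k F ω) (P p) :=
  (memLp_D hG k).integrable_mul (memLp_negDLInv p k F)

theorem summable_integral_abs_D_mul_negDLInv {p : SuccessProb} {F G : Omega → ℝ}
    (hF : MemLp F 2 (P p)) (hG : DomD p G) :
    Summable fun k => ∫ ω, |D p k G ω * negDLInv p k F ω| ∂(P p) := by
  refine Summable.of_nonneg_of_le (fun k => integral_nonneg fun ω => abs_nonneg _) (fun k => ?_)
    (hG.summable_integral_D_sq.add (summable_integral_negDLInv_sq hF))
  have h1 := (memLp_D hG.1 k).integrable_sq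
  have h2 := (memLp_negDLInv p k F).integrable_sq
  rw [← integral_add h1 h2]
  refine integral_mono (integrable_D_mul_negDLInv hG.1 k).abs (h1.add h2) fun ω => ?_
  simp only [abs_mul]
  nlinarith [sq_nonneg (|D p k G ω| - |negDLInv p k F ω|), sq_abs (D p k G ω),
    sq_abs (negDLInv p k F ω), sq_nonneg (D p k G ω), sq_nonneg (negDLInv p k F ω)]

/-- Fubini for a bounded function times `⟨DG, -DL⁻¹F⟩`. -/
theorem hasSum_integral_mul_D_mul_negDLInv {p : SuccessProb} {F G φ : Omega → ℝ}
    (hF : MemLp F 2 (P p)) (hG : DomD p G) (hφ : AEStronglyMeasurable φ (P p)) {C : ℝ}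
    (hC : ∀ ω, |φ ω| ≤ C) :
    HasSum (fun k => ∫ ω, φ ω * (D p k G ω * negDLInv p k F ω) ∂(P p))
      (∫ ω, φ ω * ∑' k, D p k G ω * negDLInv p k F ω ∂(P p)) := by
  have hint : ∀ k, Integrable (fun ω => φ ω * (D p k G ω * negDLInv p k F ω)) (P p) := fun k =>
    (integrable_D_mul_negDLInv hG.1 k).bdd_mul hφ (Filter.Eventually.of_forall hC)
  have h := hasSum_integral_of_summable_integral_norm hint ?_
  · simpa only [tsum_mul_left] using h
  · refine Summable.of_nonneg_of_le (fun k => integral_nonneg fun ω => norm_nonneg _) (fun k => ?_)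
      ((summable_integral_abs_D_mul_negDLInv hF hG).mul_left C)
    rw [← integral_const_mul]
    refine integral_mono (hint k).norm
      ((integrable_D_mul_negDLInv hG.1 k).abs.const_mul C) fun ω => ?_
    simp only [Real.norm_eq_abs, abs_mul (φ ω)]
    exact mul_le_mul_of_nonneg_right (hC ω) (abs_nonneg _)

lemma integrable_tsum_of_summable_integral_norm {α : Type*} [MeasurableSpace α] {μ : Measure α}
    {f : ℕ → α → ℝ} (hf : ∀ k, Integrable (f k) μ)
    (hs : Summable fun k => ∫ a, ‖f k a‖ ∂μ) : Integrable (fun a => ∑' k, f k a) μ := by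
  have hfin : ∫⁻ a, ∑' k, ‖f k a‖ₑ ∂μ < ∞ := by
    rw [lintegral_tsum fun k => (hf k).1.enorm]
    have h1 : ∀ k, ∫⁻ a, ‖f k a‖ₑ ∂μ = ENNReal.ofReal (∫ a, ‖f k a‖ ∂μ) := fun k =>
      (ofReal_integral_norm_eq_lintegral_enorm (hf k)).symm
    simp only [h1]
    rw [← ENNReal.ofReal_tsum_of_nonneg (fun k => integral_nonneg fun _ => norm_nonneg _) hs]
    exact ENNReal.ofReal_lt_top
  have hae : ∀ᵐ a ∂μ, Summable fun k => f k a := by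
    filter_upwards [ae_lt_top' (AEMeasurable.tsum fun k => (hf k).1.enorm) hfin.ne] with a ha
    refine Summable.of_norm ((ENNReal.summable_toReal ha.ne).congr fun k => ?_)
    simp
  refine ⟨aestronglyMeasurable_of_tendsto_ae Filter.atTop
    (f := fun n a => ∑ k ∈ Finset.range n, f k a)
    (fun n => (integrable_finsetSum _ fun k _ => hf k).1)
    (hae.mono fun a ha => ha.hasSum.tendsto_sum_nat), ?_⟩
  exact lt_of_le_of_lt (lintegral_mono fun a => enorm_tsum_le_tsum_enorm) hfin

theorem integrable_tsum_D_mul_negDLInv {p : SuccessProb} {F G : Omega → ℝ}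
    (hF : MemLp F 2 (P p)) (hG : DomD p G) :
    Integrable (fun ω => ∑' k, D p k G ω * negDLInv p k F ω) (P p) :=
  integrable_tsum_of_summable_integral_norm (fun k => integrable_D_mul_negDLInv hG.1 k)
    (summable_integral_abs_D_mul_negDLInv hF hG)

end Rademacher

namespace Rademacher

/-- A third-order Taylor estimate at the left end point, from a Lipschitz second derivative. -/
lemma taylor_left {φ φ' φ'' : ℝ → ℝ} {K : ℝ} (h1 : ∀ t, HasDerivAt φ (φ' t) t)
    (h2 : ∀ t, HasDerivAt φ' (φ'' t) t) (h3 : ∀ t, |φ'' t - φ'' 0| ≤ K * |t|) :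
    |φ 1 - φ 0 - φ' 0 - φ'' 0 / 2| ≤ K / 6 := by
  have hd1 : ∀ t, HasDerivAt (fun t => φ' t - φ' 0 - t * φ'' 0) (φ'' t - φ'' 0) t := fun t => 
    (((h2 t).sub_const (φ' 0)).sub ((hasDerivAt_id t).mul_const (φ'' 0))).congr_deriv (by simp)
  have hd0 : ∀ t, HasDerivAt (fun t => φ t - φ 0 - t * φ' 0 - t ^ 2 / 2 * φ'' 0)
      (φ' t - φ' 0 - t * φ'' 0) t := fun t =>
    ((((h1 t).sub_const (φ 0)).sub ((hasDerivAt_id t).mul_const (φ' 0))).sub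
      ((((hasDerivAt_id t).pow 2).div_const 2).mul_const (φ'' 0))).congr_deriv (by simp)
  have hB1 : ∀ t : ℝ, HasDerivAt (fun t => K * t ^ 2 / 2) (K * t) t := fun t =>
    ((((hasDerivAt_id t).pow 2).const_mul K).div_const 2).congr_deriv (by simp; ring)
  have hB0 : ∀ t : ℝ, HasDerivAt (fun t => K * t ^ 3 / 6) (K * t ^ 2 / 2) t := fun t =>
    ((((hasDerivAt_id t).pow 3).const_mul K).div_const 6).congr_deriv (by simp; ring)
  have hb1 : ∀ t ∈ Set.Icc (0 : ℝ) 1, ‖φ' t - φ' 0 - t * φ'' 0‖ ≤ K * t ^ 2 / 2 :=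
    image_norm_le_of_norm_deriv_right_le_deriv_boundary
      (fun t _ => (hd1 t).continuousAt.continuousWithinAt)
      (fun t _ => (hd1 t).hasDerivWithinAt) (by simp) hB1 fun t ht => by
        simpa [abs_of_nonneg ht.1] using h3 t
  have hb0 : ∀ t ∈ Set.Icc (0 : ℝ) 1,
      ‖φ t - φ 0 - t * φ' 0 - t ^ 2 / 2 * φ'' 0‖ ≤ K * t ^ 3 / 6 :=
    image_norm_le_of_norm_deriv_right_le_deriv_boundary
      (fun t _ => (hd0 t).continuousAt.continuousWithinAt)
      (fun t _ => (hd0 t).hasDerivWithinAt) (by simp) hB0 fun t ht =>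
        hb1 t ⟨ht.1, ht.2.le⟩
  have := hb0 1 (by simp)
  simp only [Real.norm_eq_abs, one_pow, one_mul, mul_one] at this
  convert this using 2
  ring

lemma trapezoid_left {φ φ' φ'' : ℝ → ℝ} {K : ℝ} (h1 : ∀ t, HasDerivAt φ (φ' t) t)
    (h2 : ∀ t, HasDerivAt φ' (φ'' t) t) (h3 : ∀ s t, |φ'' s - φ'' t| ≤ K * |s - t|) :
    |φ 1 - φ 0 - φ' 0 - (φ'' 0 + φ'' 1) / 4| ≤ 5 / 12 * K := by
  have ha := taylor_left h1 h2 fun t => by simpa using h3 t 0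
  have hb := h3 0 1
  simp only [zero_sub, abs_neg, abs_one, mul_one] at hb
  rw [abs_le] at *
  constructor <;> linarith [ha.1, ha.2, hb.1, hb.2]

lemma trapezoid_right {φ φ' φ'' : ℝ → ℝ} {K : ℝ} (h1 : ∀ t, HasDerivAt φ (φ' t) t)
    (h2 : ∀ t, HasDerivAt φ' (φ'' t) t) (h3 : ∀ s t, |φ'' s - φ'' t| ≤ K * |s - t|) :
    |φ 1 - φ 0 - φ' 1 + (φ'' 0 + φ'' 1) / 4| ≤ 5 / 12 * K := by
  have hsub : ∀ t : ℝ, HasDerivAt (fun t : ℝ => 1 - t) (-1) t := fun t => by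
    simpa using (hasDerivAt_id t).const_sub 1
  have := trapezoid_left (φ := fun t => φ (1 - t)) (φ' := fun t => -φ' (1 - t))
    (φ'' := fun t => φ'' (1 - t)) (K := K)
    (fun t => ((h1 (1 - t)).scomp t (hsub t)).congr_deriv (by simp))
    (fun t => ((h2 (1 - t)).scomp t (hsub t)).neg.congr_deriv (by simp))
    (fun s t => by simpa [abs_sub_comm] using h3 (1 - s) (1 - t))
  rw [← abs_neg]
  convert this using 2
  simp
  ring

/-- A function with prescribed first and second partial derivatives, bounded together with them,
and with Lipschitz second partial derivatives. -/
structure SmoothBound {d : ℕ} (h : (Fin d → ℝ) → ℝ) (h1 : Fin d → (Fin d → ℝ) → ℝ)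
    (h2 : Fin d → Fin d → (Fin d → ℝ) → ℝ) (K0 K1 K2 K3 : ℝ) : Prop where
  hasFDerivAt : ∀ x, HasFDerivAt h
    (∑ j, h1 j x • (ContinuousLinearMap.proj j : (Fin d → ℝ) →L[ℝ] ℝ)) x
  hasFDerivAt' : ∀ j x, HasFDerivAt (h1 j)
    (∑ l, h2 j l x • (ContinuousLinearMap.proj l : (Fin d → ℝ) →L[ℝ] ℝ)) x
  bound0 : ∀ x, |h x| ≤ K0
  bound1 : ∀ j x, |h1 j x| ≤ K1
  bound2 : ∀ j l x, |h2 j l x| ≤ K2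
  lipschitz2 : ∀ j l x y, |h2 j l x - h2 j l y| ≤ K3 * ∑ i, |x i - y i|
  nonneg2 : 0 ≤ K2
  nonneg3 : 0 ≤ K3

variable {d : ℕ} {h : (Fin d → ℝ) → ℝ} {h1 : Fin d → (Fin d → ℝ) → ℝ}
  {h2 : Fin d → Fin d → (Fin d → ℝ) → ℝ} {K0 K1 K2 K3 : ℝ}

lemma SmoothBound.continuous (H : SmoothBound h h1 h2 K0 K1 K2 K3) : Continuous h :=
  continuous_iff_continuousAt.2 fun x => (H.hasFDerivAt x).continuousAt

lemma SmoothBound.continuous1 (H : SmoothBound h h1 h2 K0 K1 K2 K3) (j : Fin d) :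
    Continuous (h1 j) :=
  continuous_iff_continuousAt.2 fun x => (H.hasFDerivAt' j x).continuousAt

lemma continuous_of_abs_sub_le {f : (Fin d → ℝ) → ℝ} {K : ℝ}
    (hf : ∀ x y, |f x - f y| ≤ K * ∑ i, |x i - y i|) : Continuous f := by
  refine continuous_iff_continuousAt.2 fun x => ?_
  rw [ContinuousAt, tendsto_iff_norm_sub_tendsto_zero]
  refine squeeze_zero (fun _ => norm_nonneg _) (fun y => hf y x) ?_
  have : Continuous fun y : Fin d → ℝ => K * ∑ i, |y i - x i| := by fun_prop
  simpa using this.tendsto x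

lemma SmoothBound.continuous2 (H : SmoothBound h h1 h2 K0 K1 K2 K3) (j l : Fin d) :
    Continuous (h2 j l) := continuous_of_abs_sub_le (H.lipschitz2 j l)

lemma hasDerivAt_line {f : (Fin d → ℝ) → ℝ} {f1 : Fin d → (Fin d → ℝ) → ℝ}
    (hf : ∀ x, HasFDerivAt f
      (∑ j, f1 j x • (ContinuousLinearMap.proj j : (Fin d → ℝ) →L[ℝ] ℝ)) x)
    (x v : Fin d → ℝ) (t : ℝ) :
    HasDerivAt (fun t : ℝ => f (x + t • v)) (∑ j, f1 j (x + t • v) * v j) t := by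
  have hl : HasDerivAt (fun t : ℝ => x + t • v) v t := by
    simpa using ((hasDerivAt_id t).smul_const v).const_add x
  exact ((hf (x + t • v)).comp_hasDerivAt t hl).congr_deriv (by simp)

/-- The discrete chain rule, on the values `u`, `v` of the vector at `ω^k_+`, `ω^k_-`. -/
theorem SmoothBound.taylor (H : SmoothBound h h1 h2 K0 K1 K2 K3) (u v : Fin d → ℝ) (b : Bool) :
    |h u - h v - ∑ j, h1 j (if b then u else v) * (u j - v j) +
      (if b then 1 else -1) / 4 * ∑ j, ∑ l, (h2 j l u + h2 j l v) * ((u j - v j) * (u l - v l))| ≤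
      5 / 12 * (K3 * (∑ j, |u j - v j|) ^ 3) := by
  set w : Fin d → ℝ := u - v with hw
  have hwj : ∀ j, u j - v j = w j := fun j => rfl
  simp only [hwj]
  have hu : v + (1 : ℝ) • w = u := by simp [hw]
  have hv : v + (0 : ℝ) • w = v := by simp
  have d1 : ∀ t, HasDerivAt (fun t : ℝ => h (v + t • w)) (∑ j, h1 j (v + t • w) * w j) t :=
    hasDerivAt_line H.hasFDerivAt v w
  have d2 : ∀ t, HasDerivAt (fun t : ℝ => ∑ j, h1 j (v + t • w) * w j)
      (∑ j, (∑ l, h2 j l (v + t • w) * w l) * w j) t := fun t =>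
    HasDerivAt.fun_sum fun j _ => (hasDerivAt_line (H.hasFDerivAt' j) v w t).mul_const (w j)
  have d3 : ∀ s t : ℝ, |∑ j, (∑ l, h2 j l (v + s • w) * w l) * w j -
      ∑ j, (∑ l, h2 j l (v + t • w) * w l) * w j| ≤ (K3 * (∑ j, |w j|) ^ 3) * |s - t| := by
    intro s t
    have e1 : ∑ j, (∑ l, h2 j l (v + s • w) * w l) * w j -
        ∑ j, (∑ l, h2 j l (v + t • w) * w l) * w j =
        ∑ j, ∑ l, (h2 j l (v + s • w) - h2 j l (v + t • w)) * (w l * w j) := by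
      rw [← Finset.sum_sub_distrib]
      refine Finset.sum_congr rfl fun j _ => ?_
      rw [← sub_mul, ← Finset.sum_sub_distrib, Finset.sum_mul]
      exact Finset.sum_congr rfl fun l _ => by ring
    have e2 : ∀ j l : Fin d, |(h2 j l (v + s • w) - h2 j l (v + t • w)) * (w l * w j)| ≤
        (K3 * (|s - t| * ∑ i : Fin d, |w i|)) * (|w l| * |w j|) := by
      intro j l
      rw [abs_mul, abs_mul (w l)]
      refine mul_le_mul_of_nonneg_right ((H.lipschitz2 j l _ _).trans_eq ?_) (by positivity)
      rw [Finset.mul_sum _ _ |s - t|]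
      refine congrArg (K3 * ·) (Finset.sum_congr rfl fun i _ => ?_)
      rw [← abs_mul]
      congr 1
      simp
      ring
    rw [e1]
    calc |∑ j, ∑ l, (h2 j l (v + s • w) - h2 j l (v + t • w)) * (w l * w j)|
        ≤ ∑ j, ∑ l, (K3 * (|s - t| * ∑ i, |w i|)) * (|w l| * |w j|) :=
          (Finset.abs_sum_le_sum_abs _ _).trans (Finset.sum_le_sum fun j _ =>
            (Finset.abs_sum_le_sum_abs _ _).trans (Finset.sum_le_sum fun l _ => e2 j l))
      _ = _ := by
          simp only [← Finset.mul_sum, ← Finset.sum_mul]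
          ring
  have e3 : ∑ j, ∑ l, (h2 j l u + h2 j l v) * (w j * w l) =
      ∑ j, (∑ l, h2 j l v * w l) * w j + ∑ j, (∑ l, h2 j l u * w l) * w j := by
    rw [← Finset.sum_add_distrib]
    refine Finset.sum_congr rfl fun j _ => ?_
    rw [Finset.sum_mul, Finset.sum_mul, ← Finset.sum_add_distrib]
    exact Finset.sum_congr rfl fun l _ => by ring
  rw [e3]
  cases b
  · have := trapezoid_left d1 d2 d3
    simp only [hu, hv] at this
    convert this using 2
    simp
    ring
  · have := trapezoid_right d1 d2 d3
    simp only [hu, hv] at this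
    convert this using 2
    simp
    ring

end Rademacher

namespace Rademacher

variable {d : ℕ} {h : (Fin d → ℝ) → ℝ} {h1 : Fin d → (Fin d → ℝ) → ℝ}
  {h2 : Fin d → Fin d → (Fin d → ℝ) → ℝ} {K0 K1 K2 K3 : ℝ}

/-- The second-order term in the discrete chain rule, without the factor `X_k`. -/
def secondOrder (p : SuccessProb) (F : Fin d → Omega → ℝ)
    (h2 : Fin d → Fin d → (Fin d → ℝ) → ℝ) (k : ℕ) (ω : Omega) : ℝ :=
  1 / (4 * √(pq p k)) * ∑ j, ∑ l, (h2 j l (fun i => F i (Function.update ω k true)) +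
    h2 j l (fun i => F i (Function.update ω k false))) * (D p k (F j) ω * D p k (F l) ω)

lemma secondOrder_update (p : SuccessProb) (F : Fin d → Omega → ℝ)
    (h2 : Fin d → Fin d → (Fin d → ℝ) → ℝ) (k : ℕ) (b : Bool) (ω : Omega) :
    secondOrder p F h2 k (Function.update ω k b) = secondOrder p F h2 k ω := by
  simp [secondOrder, D_update]

theorem SmoothBound.abs_D_comp_sub_le (H : SmoothBound h h1 h2 K0 K1 K2 K3) (p : SuccessProb)
    (F : Fin d → Omega → ℝ) (k : ℕ) (ω : Omega) :
    |D p k (fun ω => h fun i => F i ω) ω - ∑ j, h1 j (fun i => F i ω) * D p k (F j) ω +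
      X k ω * secondOrder p F h2 k ω| ≤
      5 / 12 * K3 * (1 / pq p k * (∑ j, |D p k (F j) ω|) ^ 3) := by
  have hr := Real.sqrt_pos.2 (pq_pos p k)
  have hr2 : pq p k = √(pq p k) ^ 2 := (Real.sq_sqrt (pq_pos p k).le).symm
  set r := √(pq p k)
  have hT := H.taylor (fun i => F i (Function.update ω k true))
    (fun i => F i (Function.update ω k false)) (ω k)
  have hω : (if ω k = true then (fun i => F i (Function.update ω k true))
      else fun i => F i (Function.update ω k false)) = fun i => F i ω := by
    cases hk : ω k <;> simp [← hk, Function.update_eq_self]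
  rw [hω] at hT
  have hX : X k ω = if ω k = true then 1 else -1 := rfl
  rw [← hX] at hT
  have hD : ∀ G : Omega → ℝ, D p k G ω =
      r * (G (Function.update ω k true) - G (Function.update ω k false)) := fun G => rfl
  have e1 : D p k (fun ω => h fun i => F i ω) ω - ∑ j, h1 j (fun i => F i ω) * D p k (F j) ω +
      X k ω * secondOrder p F h2 k ω =
      r * (h (fun i => F i (Function.update ω k true)) -
        h (fun i => F i (Function.update ω k false)) -
        ∑ j, h1 j (fun i => F i ω) *
          (F j (Function.update ω k true) - F j (Function.update ω k false)) +
        X k ω / 4 * ∑ j, ∑ l, (h2 j l (fun i => F i (Function.update ω k true)) +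
            h2 j l (fun i => F i (Function.update ω k false))) *
          ((F j (Function.update ω k true) - F j (Function.update ω k false)) *
            (F l (Function.update ω k true) - F l (Function.update ω k false)))) := by
    have a1 : ∑ j, h1 j (fun i => F i ω) * D p k (F j) ω = r * ∑ j, h1 j (fun i => F i ω) *
        (F j (Function.update ω k true) - F j (Function.update ω k false)) := by
      rw [Finset.mul_sum]
      exact Finset.sum_congr rfl fun j _ => by rw [hD]; ring
    have a2 : secondOrder p F h2 k ω = r / 4 * ∑ j, ∑ l,
        (h2 j l (fun i => F i (Function.update ω k true)) +
            h2 j l (fun i => F i (Function.update ω k false))) *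
          ((F j (Function.update ω k true) - F j (Function.update ω k false)) *
            (F l (Function.update ω k true) - F l (Function.update ω k false))) := by
      change 1 / (4 * r) * _ = _
      simp only [Finset.mul_sum]
      refine Finset.sum_congr rfl fun j _ => Finset.sum_congr rfl fun l _ => ?_
      rw [hD, hD]
      field_simp
    rw [a1, a2, hD]
    ring
  have e2 : 5 / 12 * K3 * (1 / pq p k * (∑ j, |D p k (F j) ω|) ^ 3) = r * (5 / 12 * (K3 *
      (∑ j, |F j (Function.update ω k true) - F j (Function.update ω k false)|) ^ 3)) := by
    simp only [hD, abs_mul, abs_of_pos hr, ← Finset.mul_sum]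
    rw [hr2]
    field_simp
  rw [e1, e2, abs_mul, abs_of_pos hr]
  exact mul_le_mul_of_nonneg_left hT hr.le

lemma SmoothBound.abs_secondOrder_le (H : SmoothBound h h1 h2 K0 K1 K2 K3) (p : SuccessProb)
    (F : Fin d → Omega → ℝ) (k : ℕ) (ω : Omega) :
    |secondOrder p F h2 k ω| ≤ K2 / (2 * √(pq p k)) * (∑ j, |D p k (F j) ω|) ^ 2 := by
  have hr := Real.sqrt_pos.2 (pq_pos p k)
  rw [secondOrder, abs_mul, abs_of_pos (by positivity : 0 < 1 / (4 * √(pq p k)))]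
  have e1 : |∑ j, ∑ l, (h2 j l (fun i => F i (Function.update ω k true)) +
      h2 j l (fun i => F i (Function.update ω k false))) * (D p k (F j) ω * D p k (F l) ω)| ≤
      ∑ j, ∑ l, (2 * K2) * (|D p k (F j) ω| * |D p k (F l) ω|) := by
    refine (Finset.abs_sum_le_sum_abs _ _).trans (Finset.sum_le_sum fun j _ =>
      (Finset.abs_sum_le_sum_abs _ _).trans (Finset.sum_le_sum fun l _ => ?_))
    rw [abs_mul, abs_mul (D p k (F j) ω)]
    refine mul_le_mul_of_nonneg_right ((abs_add_le _ _).trans ?_) (by positivity)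
    linarith [H.bound2 j l fun i => F i (Function.update ω k true),
      H.bound2 j l fun i => F i (Function.update ω k false)]
  refine (mul_le_mul_of_nonneg_left e1 (by positivity)).trans_eq ?_
  simp only [← Finset.mul_sum, ← Finset.sum_mul]
  field_simp
  ring

/-- The fourth moment condition for a single coordinate. -/
lemma integrable_D_pow_four {p : SuccessProb} {F : Omega → ℝ} (hF : MemLp F 2 (P p))
    (hF4 : ∫⁻ ω, ∑' k : ℕ, ENNReal.ofReal (|(pq p k) ^ (-(1 / 4) : ℝ) * D p k F ω| ^ 4) ∂(P p) < ∞)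
    (k : ℕ) : Integrable (fun ω => D p k F ω ^ 4) (P p) := by
  have hm := (memLp_D hF k).aestronglyMeasurable
  set c := (pq p k) ^ (-(1 / 4) : ℝ) with hc
  have hc0 : 0 < c := Real.rpow_pos_of_pos (pq_pos p k) _
  have h1 : Integrable (fun ω => |c * D p k F ω| ^ 4) (P p) := by
    refine ⟨((hm.const_mul c).norm.pow 4), ?_⟩
    refine lt_of_le_of_lt (lintegral_mono fun ω => ?_) hF4
    rw [Real.enorm_eq_ofReal (by positivity)]
    exact ENNReal.le_tsum (f := fun k : ℕ =>
      ENNReal.ofReal (|(pq p k) ^ (-(1 / 4) : ℝ) * D p k F ω| ^ 4)) k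
  refine (h1.const_mul (c ^ 4)⁻¹).congr (Filter.Eventually.of_forall fun ω => ?_)
  simp only [abs_mul, mul_pow, abs_of_pos hc0, (by decide : Even 4).pow_abs]
  field_simp

lemma memLp_D_mul_D {p : SuccessProb} {F G : Omega → ℝ} (hF : MemLp F 2 (P p))
    (hG : MemLp G 2 (P p)) {k : ℕ} (hF4 : Integrable (fun ω => D p k F ω ^ 4) (P p))
    (hG4 : Integrable (fun ω => D p k G ω ^ 4) (P p)) :
    MemLp (fun ω => D p k F ω * D p k G ω) 2 (P p) := by
  have hm : AEStronglyMeasurable (fun ω => D p k F ω * D p k G ω) (P p) :=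
    (memLp_D hF k).aestronglyMeasurable.mul (memLp_D hG k).aestronglyMeasurable
  rw [memLp_two_iff_integrable_sq hm]
  refine (hF4.add hG4).mono' (hm.pow 2) (Filter.Eventually.of_forall fun ω => ?_)
  rw [Real.norm_eq_abs, abs_of_nonneg (sq_nonneg _)]
  simp only [Pi.add_apply]
  nlinarith [sq_nonneg (D p k F ω ^ 2 - D p k G ω ^ 2), sq_nonneg (D p k F ω ^ 2),
    sq_nonneg (D p k G ω ^ 2)]

lemma aemeasurable_vec {p : SuccessProb} {F : Fin d → Omega → ℝ}
    (hF : ∀ i, MemLp (F i) 2 (P p)) : AEMeasurable (fun ω i => F i ω) (P p) :=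
  aemeasurable_pi_iff.2 fun i => (hF i).aestronglyMeasurable.aemeasurable

lemma integrable_secondOrder_mul (H : SmoothBound h h1 h2 K0 K1 K2 K3) {p : SuccessProb}
    {F : Fin d → Omega → ℝ} (hF : ∀ i, MemLp (F i) 2 (P p)) {k : ℕ}
    (hF4 : ∀ i, Integrable (fun ω => D p k (F i) ω ^ 4) (P p)) {G : Omega → ℝ}
    (hG : MemLp G 2 (P p)) : Integrable (fun ω => secondOrder p F h2 k ω * G ω) (P p) := by
  have hm : ∀ j l b, AEStronglyMeasurable
      (fun ω => h2 j l fun i => F i (Function.update ω k b)) (P p) := fun j l b =>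
    ((H.continuous2 j l).measurable.comp_aemeasurable
      (aemeasurable_vec fun i => MemLp.comp_update (hF i) k b)).aestronglyMeasurable
  have h3 : Integrable (fun ω => 1 / (4 * √(pq p k)) * ∑ j, ∑ l,
      (h2 j l (fun i => F i (Function.update ω k true)) +
        h2 j l (fun i => F i (Function.update ω k false))) *
      ((D p k (F j) ω * D p k (F l) ω) * G ω)) (P p) := by
    refine Integrable.const_mul (integrable_finsetSum _ fun j _ => integrable_finsetSum _
      fun l _ => ?_) _
    refine ((memLp_D_mul_D (hF j) (hF l) (hF4 j) (hF4 l)).integrable_mul hG).bdd_mul (c := 2 * K2)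
      ((hm j l true).add (hm j l false)) (Filter.Eventually.of_forall fun ω => ?_)
    refine (norm_add_le _ _).trans ?_
    linarith [H.bound2 j l fun i => F i (Function.update ω k true),
      H.bound2 j l fun i => F i (Function.update ω k false),
      Real.norm_eq_abs (h2 j l fun i => F i (Function.update ω k true)),
      Real.norm_eq_abs (h2 j l fun i => F i (Function.update ω k false))]
  refine h3.congr (Filter.Eventually.of_forall fun ω => ?_)
  simp only [secondOrder, mul_assoc, Finset.sum_mul]

lemma SmoothBound.memLp_comp (H : SmoothBound h h1 h2 K0 K1 K2 K3) {p : SuccessProb}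
    {F : Fin d → Omega → ℝ} (hF : ∀ i, MemLp (F i) 2 (P p)) :
    MemLp (fun ω => h fun i => F i ω) 2 (P p) :=
  MemLp.of_bound (H.continuous.measurable.comp_aemeasurable
    (aemeasurable_vec hF)).aestronglyMeasurable K0 (Filter.Eventually.of_forall fun _ => H.bound0 _)

lemma SmoothBound.aestronglyMeasurable1 (H : SmoothBound h h1 h2 K0 K1 K2 K3) {p : SuccessProb}
    {F : Fin d → Omega → ℝ} (hF : ∀ i, MemLp (F i) 2 (P p)) (j : Fin d) :
    AEStronglyMeasurable (fun ω => h1 j fun i => F i ω) (P p) :=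
  ((H.continuous1 j).measurable.comp_aemeasurable (aemeasurable_vec hF)).aestronglyMeasurable

/-- The error in the chain rule at a single coordinate, tested against `-D_k L⁻¹G`. -/
theorem SmoothBound.enorm_integral_D_sub_le (H : SmoothBound h h1 h2 K0 K1 K2 K3)
    {p : SuccessProb} {F : Fin d → Omega → ℝ} (hF : ∀ i, MemLp (F i) 2 (P p)) {k : ℕ}
    (hF4 : ∀ i, Integrable (fun ω => D p k (F i) ω ^ 4) (P p)) (G : Omega → ℝ) :
    ‖(∫ ω, D p k (fun ω => h fun i => F i ω) ω * negDLInv p k G ω ∂(P p)) -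
      ∑ j, ∫ ω, h1 j (fun i => F i ω) * (D p k (F j) ω * negDLInv p k G ω) ∂(P p)‖ₑ ≤
    ENNReal.ofReal (K2 / 2) * ∫⁻ ω, ENNReal.ofReal (|pSubQ p k| / √(pq p k) *
        (∑ j, |D p k (F j) ω|) ^ 2 * |negDLInv p k G ω|) ∂(P p) +
      ENNReal.ofReal (5 / 12 * K3) * ∫⁻ ω, ENNReal.ofReal (1 / pq p k *
        (∑ j, |D p k (F j) ω|) ^ 3 * |negDLInv p k G ω|) ∂(P p) := by
  have hpos := pq_pos p k
  have hr := Real.sqrt_pos.2 hpos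
  have hL := memLp_negDLInv p k G
  have i1 : Integrable (fun ω => D p k (fun ω => h fun i => F i ω) ω * negDLInv p k G ω) (P p) :=
    integrable_D_mul_negDLInv (H.memLp_comp hF) k
  have i2 : ∀ j, Integrable
      (fun ω => h1 j (fun i => F i ω) * (D p k (F j) ω * negDLInv p k G ω)) (P p) := fun j =>
    (integrable_D_mul_negDLInv (hF j) k).bdd_mul (H.aestronglyMeasurable1 hF j)
      (Filter.Eventually.of_forall fun _ => H.bound1 j _)
  have i3 := integrable_secondOrder_mul H hF hF4 hL
  have hX : Measurable (X k) :=
    (measurable_of_finite fun b : Bool => if b then (1 : ℝ) else -1).comp (measurable_pi_apply k)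
  have i4 : Integrable (fun ω => X k ω * (secondOrder p F h2 k ω * negDLInv p k G ω)) (P p) :=
    i3.bdd_mul (c := 1) hX.aestronglyMeasurable
      (Filter.Eventually.of_forall fun ω => by unfold X; split_ifs <;> simp)
  have e1 : (∫ ω, D p k (fun ω => h fun i => F i ω) ω * negDLInv p k G ω ∂(P p)) -
      ∑ j, ∫ ω, h1 j (fun i => F i ω) * (D p k (F j) ω * negDLInv p k G ω) ∂(P p) =
      -(pSubQ p k * ∫ ω, secondOrder p F h2 k ω * negDLInv p k G ω ∂(P p)) +
      ∫ ω, (D p k (fun ω => h fun i => F i ω) ω - ∑ j, h1 j (fun i => F i ω) * D p k (F j) ω +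
        X k ω * secondOrder p F h2 k ω) * negDLInv p k G ω ∂(P p) := by
    rw [← integral_X_mul k i3 fun b ω => by rw [secondOrder_update, negDLInv_update],
      ← integral_finsetSum _ fun j _ => i2 j, ← integral_sub i1 (integrable_finsetSum _ fun j _ =>
        i2 j), ← integral_neg]
    refine Eq.trans ?_ (integral_add i4.neg ?_)
    · refine integral_congr_ae (Filter.Eventually.of_forall fun ω => ?_)
      simp only [add_mul, sub_mul, Finset.sum_mul, mul_assoc]
      ring
    · refine ((i1.sub (integrable_finsetSum Finset.univ fun j _ => i2 j)).add i4).congr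
        (Filter.Eventually.of_forall fun ω => ?_)
      simp only [Pi.add_apply, Pi.sub_apply, add_mul, sub_mul, Finset.sum_mul, mul_assoc]
  rw [e1]
  refine (enorm_add_le _ _).trans (add_le_add ?_ ?_)
  · rw [enorm_neg, ← integral_const_mul]
    refine (enorm_integral_le_lintegral_enorm _).trans ?_
    rw [← lintegral_const_mul' _ _ ENNReal.ofReal_ne_top]
    refine lintegral_mono fun ω => ?_
    rw [← ENNReal.ofReal_mul (by linarith [H.nonneg2]), Real.enorm_eq_ofReal_abs]
    refine ENNReal.ofReal_le_ofReal ?_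
    rw [abs_mul, abs_mul]
    calc |pSubQ p k| * (|secondOrder p F h2 k ω| * |negDLInv p k G ω|)
        ≤ |pSubQ p k| * (K2 / (2 * √(pq p k)) * (∑ j, |D p k (F j) ω|) ^ 2 *
            |negDLInv p k G ω|) := by
          gcongr
          exact H.abs_secondOrder_le p F k ω
      _ = _ := by field_simp
  · refine (enorm_integral_le_lintegral_enorm _).trans ?_
    rw [← lintegral_const_mul' _ _ ENNReal.ofReal_ne_top]
    refine lintegral_mono fun ω => ?_
    rw [← ENNReal.ofReal_mul (by linarith [H.nonneg3]), Real.enorm_eq_ofReal_abs]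
    refine ENNReal.ofReal_le_ofReal ?_
    rw [abs_mul, ← mul_assoc]
    exact mul_le_mul_of_nonneg_right (H.abs_D_comp_sub_le p F k ω) (abs_nonneg _)

/-- The contribution of a single component to `A₂`, up to the constant. -/
def secondOrderBound (p : SuccessProb) (F : Fin d → Omega → ℝ) (G : Omega → ℝ) : ℝ≥0∞ :=
  ∫⁻ ω, ∑' k, ENNReal.ofReal (|pSubQ p k| / √(pq p k) *
    (∑ j, |D p k (F j) ω|) ^ 2 * |negDLInv p k G ω|) ∂(P p)

/-- The contribution of a single component to `A₃`, up to the constant. -/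
def thirdOrderBound (p : SuccessProb) (F : Fin d → Omega → ℝ) (G : Omega → ℝ) : ℝ≥0∞ :=
  ∫⁻ ω, ∑' k, ENNReal.ofReal (1 / pq p k *
    (∑ j, |D p k (F j) ω|) ^ 3 * |negDLInv p k G ω|) ∂(P p)

lemma aemeasurable_sum_abs_D {p : SuccessProb} {F : Fin d → Omega → ℝ}
    (hF : ∀ i, MemLp (F i) 2 (P p)) (k : ℕ) :
    AEMeasurable (fun ω => ∑ j, |D p k (F j) ω|) (P p) :=
  Finset.aemeasurable_fun_sum _ fun j _ =>
    (memLp_D (hF j) k).aestronglyMeasurable.aemeasurable.norm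

lemma aemeasurable_term {p : SuccessProb} {F : Fin d → Omega → ℝ}
    (hF : ∀ i, MemLp (F i) 2 (P p)) (G : Omega → ℝ) (c : ℝ) (n k : ℕ) :
    AEMeasurable (fun ω => ENNReal.ofReal
      (c * (∑ j, |D p k (F j) ω|) ^ n * |negDLInv p k G ω|)) (P p) :=
  ((((aemeasurable_sum_abs_D hF k).pow_const n).const_mul c).mul
    (memLp_negDLInv p k G).aestronglyMeasurable.aemeasurable.norm).ennreal_ofReal

/-- The approximate integration by parts formula for smooth functions of a Rademacher vector. -/
theorem SmoothBound.enorm_integral_mul_sub_le (H : SmoothBound h h1 h2 K0 K1 K2 K3)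
    {p : SuccessProb} {F : Fin d → Omega → ℝ} (hF : ∀ i, DomD p (F i))
    (hF4 : ∀ i k, Integrable (fun ω => D p k (F i) ω ^ 4) (P p)) {G : Omega → ℝ}
    (hG : MemLp G 2 (P p)) (hG0 : ∫ ω, G ω ∂(P p) = 0) :
    ‖(∫ ω, h (fun i => F i ω) * G ω ∂(P p)) -
      ∑ j, ∫ ω, h1 j (fun i => F i ω) * ∑' k, D p k (F j) ω * negDLInv p k G ω ∂(P p)‖ₑ ≤
    ENNReal.ofReal (K2 / 2) * secondOrderBound p F G +
      ENNReal.ofReal (5 / 12 * K3) * thirdOrderBound p F G := by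
  have hF2 : ∀ i, MemLp (F i) 2 (P p) := fun i => (hF i).1
  have s1 := integration_by_parts hG hG0 (H.memLp_comp hF2)
  have s2 := hasSum_sum (s := Finset.univ) fun (j : Fin d) _ =>
    hasSum_integral_mul_D_mul_negDLInv hG (hF j) (H.aestronglyMeasurable1 hF2 j)
      (H.bound1 j <| fun i => F i ·)
  have s3 := s1.sub s2
  rw [← s3.tsum_eq]
  refine enorm_tsum_le_tsum_enorm.trans ?_
  rw [secondOrderBound, thirdOrderBound, lintegral_tsum fun k => aemeasurable_term hF2 G _ 2 k,
    lintegral_tsum fun k => aemeasurable_term hF2 G _ 3 k, ← ENNReal.tsum_mul_left,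
    ← ENNReal.tsum_mul_left, ← ENNReal.tsum_add]
  exact ENNReal.tsum_le_tsum fun k => H.enorm_integral_D_sub_le hF2 (fun i => hF4 i k) G

lemma A2_eq {p : SuccessProb} {F : Fin d → Omega → ℝ} (hF : ∀ i, MemLp (F i) 2 (P p)) :
    A2 p F = 1 / 4 * ∑ i, secondOrderBound p F (F i) := by
  simp only [A2, secondOrderBound]
  rw [← lintegral_finsetSum' _ fun i _ => AEMeasurable.tsum fun k =>
    aemeasurable_term hF (F i) _ 2 k]
  congr 1
  refine lintegral_congr fun ω => ?_
  rw [← (Summable.tsum_finsetSum fun i _ => ENNReal.summable)]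
  refine tsum_congr fun k => ?_
  rw [Finset.mul_sum, ENNReal.ofReal_sum_of_nonneg fun i _ => by positivity]

lemma A3_eq {p : SuccessProb} {F : Fin d → Omega → ℝ} (hF : ∀ i, MemLp (F i) 2 (P p)) :
    A3 p F = 5 / 24 * ∑ i, thirdOrderBound p F (F i) := by
  simp only [A3, thirdOrderBound]
  rw [← lintegral_finsetSum' _ fun i _ => AEMeasurable.tsum fun k =>
    aemeasurable_term hF (F i) _ 3 k]
  congr 1
  refine lintegral_congr fun ω => ?_
  rw [← (Summable.tsum_finsetSum fun i _ => ENNReal.summable)]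
  refine tsum_congr fun k => ?_
  have := pq_pos p k
  rw [Finset.mul_sum, ENNReal.ofReal_sum_of_nonneg fun i _ => by positivity]

end Rademacher

namespace Rademacher

variable {d : ℕ}

lemma hasDerivAt_update {φ : (Fin d → ℝ) → ℝ} {φ' : Fin d → (Fin d → ℝ) → ℝ}
    (hφ : ∀ i x, HasLineDerivAt ℝ φ (φ' i x) x (Pi.single i 1)) (i : Fin d) (x : Fin d → ℝ)
    (t : ℝ) :
    HasDerivAt (fun t => φ (Function.update x i t)) (φ' i (Function.update x i t)) t := by
  have h1 : HasDerivAt (fun s : ℝ => φ (Function.update x i t + s • Pi.single i 1))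
      (φ' i (Function.update x i t)) 0 := hφ i _
  have h2 : HasDerivAt (fun s : ℝ => s - t) 1 t := (hasDerivAt_id t).sub_const t
  refine ((h1.comp_of_eq t h2 (sub_self t).symm).congr_deriv (mul_one _)).congr_of_eventuallyEq
    (Filter.Eventually.of_forall fun s => ?_)
  simp only [Function.comp_apply]
  congr 1
  funext j
  by_cases hj : j = i
  · subst hj; simp
  · simp [hj]

/-- A mean value inequality from bounds on the partial derivatives in a box. -/
lemma abs_sub_le_of_partial_le {φ : (Fin d → ℝ) → ℝ} {φ' : Fin d → (Fin d → ℝ) → ℝ}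
    (hφ : ∀ i x, HasLineDerivAt ℝ φ (φ' i x) x (Pi.single i 1)) {x y : Fin d → ℝ} {C : ℝ}
    (hC : ∀ i z, (∀ j, z j ∈ Set.uIcc (x j) (y j)) → |φ' i z| ≤ C) :
    |φ y - φ x| ≤ C * ∑ i, |y i - x i| := by
  have key : ∀ s : Finset (Fin d), |φ (s.piecewise y x) - φ x| ≤ C * ∑ i ∈ s, |y i - x i| := by
    intro s
    induction s using Finset.induction with
    | empty => simp
    | insert a s ha ih =>
      have hstep : |φ (Function.update (s.piecewise y x) a (y a)) -
          φ (Function.update (s.piecewise y x) a (x a))| ≤ C * |y a - x a| := by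
        refine (convex_uIcc (x a) (y a)).norm_image_sub_le_of_norm_hasDerivWithin_le
          (fun t _ => (hasDerivAt_update hφ a (s.piecewise y x) t).hasDerivWithinAt)
          (fun t ht => hC a _ fun j => ?_) Set.left_mem_uIcc Set.right_mem_uIcc
        by_cases hj : j = a
        · subst hj; simpa using ht
        · by_cases hjs : j ∈ s <;> simp [hj, hjs]
      have hx : Function.update (s.piecewise y x) a (x a) = s.piecewise y x := by
        rw [Function.update_eq_self_iff]
        simp [ha]
      rw [hx] at hstep
      rw [Finset.piecewise_insert, Finset.sum_insert ha, mul_add]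
      calc |φ (Function.update (s.piecewise y x) a (y a)) - φ x|
          ≤ |φ (Function.update (s.piecewise y x) a (y a)) - φ (s.piecewise y x)| +
            |φ (s.piecewise y x) - φ x| := abs_sub_le _ _ _
        _ ≤ _ := add_le_add hstep ih
  simpa using key Finset.univ

/-- Lipschitz partial derivatives imply differentiability. -/
lemma hasFDerivAt_of_partial_lipschitz {φ : (Fin d → ℝ) → ℝ} {φ' : Fin d → (Fin d → ℝ) → ℝ}
    (hφ : ∀ i x, HasLineDerivAt ℝ φ (φ' i x) x (Pi.single i 1))
    (hL : ∀ i x y, |φ' i x - φ' i y| ≤ ∑ j, |x j - y j|) (x : Fin d → ℝ) :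
    HasFDerivAt φ (∑ j, φ' j x • (ContinuousLinearMap.proj j : (Fin d → ℝ) →L[ℝ] ℝ)) x := by
  set A : (Fin d → ℝ) →L[ℝ] ℝ := ∑ j, φ' j x • ContinuousLinearMap.proj j with hA
  have hA1 : ∀ i, A (Pi.single i 1) = φ' i x := by
    intro i
    simp [hA, Pi.single_apply]
  have hψ : ∀ i z, HasLineDerivAt ℝ (fun z => φ z - A z) (φ' i z - φ' i x) z (Pi.single i 1) := by
    intro i z
    have h1 : HasLineDerivAt ℝ A (φ' i x) z (Pi.single i 1) := by
      have := (A.hasFDerivAt (x := z)).hasLineDerivAt (Pi.single i 1)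
      rwa [hA1] at this
    exact HasDerivAt.sub (hφ i z) h1
  have hbound : ∀ y, |(φ y - A y) - (φ x - A x)| ≤ (d : ℝ) ^ 2 * ‖y - x‖ ^ 2 := by
    intro y
    have hsum : ∑ j, |y j - x j| ≤ d * ‖y - x‖ := by
      calc ∑ j, |y j - x j| ≤ ∑ _j : Fin d, ‖y - x‖ :=
            Finset.sum_le_sum fun j _ => norm_le_pi_norm (y - x) j
        _ = _ := by simp
    have h1 := abs_sub_le_of_partial_le hψ (x := x) (y := y) (C := ∑ j, |y j - x j|)
      fun i z hz => (hL i z x).trans (Finset.sum_le_sum fun j _ => by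
        simpa [abs_sub_comm] using Set.abs_sub_left_of_mem_uIcc (hz j))
    refine h1.trans ?_
    have h0 : 0 ≤ ∑ j, |y j - x j| := Finset.sum_nonneg fun _ _ => abs_nonneg _
    nlinarith
  have hO : (fun y => (φ y - A y) - (φ x - A x)) =O[nhds x] fun y => ‖y - x‖ ^ 2 :=
    Asymptotics.IsBigO.of_bound ((d : ℝ) ^ 2) (Filter.Eventually.of_forall fun y => by
      simpa [abs_of_nonneg (sq_nonneg ‖y - x‖)] using hbound y)
  have h2 := (hO.hasFDerivAt one_lt_two).add (A.hasFDerivAt (x := x))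
  rw [zero_add] at h2
  have h3 := h2.add_const (φ x - A x)
  refine h3.congr_of_eventuallyEq (Filter.Eventually.of_forall fun y => ?_)
  simp only [Pi.add_apply]
  ring

lemma abs_iterPartial_le {g : (Fin d → ℝ) → ℝ} {k : ℕ} (h : M k g ≤ 1) {l : List (Fin d)}
    (hl : l.length = k) (x : Fin d → ℝ) : |iterPartial g l x| ≤ 1 := by
  subst hl
  have h1 : ENNReal.ofReal |iterPartial g (List.ofFn l.get) x| ≤ M l.length g :=
    le_iSup₂ (f := fun (i : Fin l.length → Fin d) (x : Fin d → ℝ) =>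
      ENNReal.ofReal |iterPartial g (List.ofFn i) x|) l.get x
  rw [List.ofFn_get] at h1
  exact ENNReal.ofReal_le_one.1 (h1.trans h)

/-- A thrice differentiable function with partial derivatives of orders one to three bounded by
one, those of order three being Lipschitz. -/
structure SmoothTest (g : (Fin d → ℝ) → ℝ) (g1 : Fin d → (Fin d → ℝ) → ℝ)
    (g2 : Fin d → Fin d → (Fin d → ℝ) → ℝ) (g3 : Fin d → Fin d → Fin d → (Fin d → ℝ) → ℝ) :
    Prop where
  hasFDerivAt : ∀ x, HasFDerivAt g
    (∑ i, g1 i x • (ContinuousLinearMap.proj i : (Fin d → ℝ) →L[ℝ] ℝ)) x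
  hasFDerivAt1 : ∀ i x, HasFDerivAt (g1 i)
    (∑ j, g2 i j x • (ContinuousLinearMap.proj j : (Fin d → ℝ) →L[ℝ] ℝ)) x
  hasFDerivAt2 : ∀ i j x, HasFDerivAt (g2 i j)
    (∑ l, g3 i j l x • (ContinuousLinearMap.proj l : (Fin d → ℝ) →L[ℝ] ℝ)) x
  bound1 : ∀ i x, |g1 i x| ≤ 1
  bound2 : ∀ i j x, |g2 i j x| ≤ 1
  bound3 : ∀ i j l x, |g3 i j l x| ≤ 1
  lipschitz : ∀ x y, |g x - g y| ≤ ∑ i, |x i - y i|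
  lipschitz3 : ∀ i j l x y, |g3 i j l x - g3 i j l y| ≤ ∑ m, |x m - y m|

theorem exists_smoothTest {g : (Fin d → ℝ) → ℝ} (hg : g ∈ TestFun d) :
    ∃ g1 g2 g3, SmoothTest g g1 g2 g3 := by
  obtain ⟨hd, hM1, hM2, hM3, hM4⟩ := hg
  have hline : ∀ l : List (Fin d), l.length < 4 → ∀ i x,
      HasLineDerivAt ℝ (iterPartial g l) (iterPartial g (i :: l) x) x (Pi.single i 1) :=
    fun l hl i x => (hd l hl i x).hasLineDerivAt
  have hb : ∀ l : List (Fin d), 0 < l.length → l.length ≤ 4 → ∀ x, |iterPartial g l x| ≤ 1 := by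
    intro l h0 h4 x
    have : l.length = 1 ∨ l.length = 2 ∨ l.length = 3 ∨ l.length = 4 := by omega
    rcases this with h | h | h | h
    exacts [abs_iterPartial_le hM1 h x, abs_iterPartial_le hM2 h x, abs_iterPartial_le hM3 h x,
      abs_iterPartial_le hM4 h x]
  have hlip : ∀ l : List (Fin d), l.length < 4 → ∀ x y,
      |iterPartial g l x - iterPartial g l y| ≤ ∑ i, |x i - y i| := by
    intro l hl x y
    simpa using abs_sub_le_of_partial_le (hline l hl) (x := y) (y := x) (C := 1)
      fun i z _ => hb (i :: l) (by simp) (by simpa using hl) z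
  have hfd : ∀ l : List (Fin d), l.length < 3 → ∀ x, HasFDerivAt (iterPartial g l)
      (∑ j, iterPartial g (j :: l) x • (ContinuousLinearMap.proj j : (Fin d → ℝ) →L[ℝ] ℝ)) x :=
    fun l hl x => hasFDerivAt_of_partial_lipschitz (φ' := fun i => iterPartial g (i :: l))
      (hline l (by omega)) (fun i x y => hlip (i :: l) (by simp; omega) x y) x
  exact ⟨fun i => iterPartial g [i], fun i j => iterPartial g [j, i],
    fun i j l => iterPartial g [l, j, i],
    { hasFDerivAt := hfd [] (by simp)
      hasFDerivAt1 := fun i => hfd [i] (by simp)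
      hasFDerivAt2 := fun i j => hfd [j, i] (by simp)
      bound1 := fun i => hb _ (by simp) (by simp)
      bound2 := fun i j => hb _ (by simp) (by simp)
      bound3 := fun i j l => hb _ (by simp) (by simp)
      lipschitz := hlip [] (by simp)
      lipschitz3 := fun i j l => hlip _ (by simp) }⟩

lemma hasFDerivAt_comp_affine {f : (Fin d → ℝ) → ℝ} {f1 : Fin d → (Fin d → ℝ) → ℝ}
    (hf : ∀ x, HasFDerivAt f
      (∑ j, f1 j x • (ContinuousLinearMap.proj j : (Fin d → ℝ) →L[ℝ] ℝ)) x)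
    (c : ℝ) (b x : Fin d → ℝ) :
    HasFDerivAt (fun x => f (c • x + b))
      (∑ j, (c * f1 j (c • x + b)) • (ContinuousLinearMap.proj j : (Fin d → ℝ) →L[ℝ] ℝ)) x := by
  have h1 : HasFDerivAt (fun x : Fin d → ℝ => c • x + b)
      (c • ContinuousLinearMap.id ℝ (Fin d → ℝ)) x :=
    ((hasFDerivAt_id x).const_smul c).add_const b
  refine ((hf (c • x + b)).comp x h1).congr_fderiv ?_
  ext v
  simp [Finset.mul_sum, mul_assoc]

lemma SmoothTest.smoothBound {g : (Fin d → ℝ) → ℝ} {g1 : Fin d → (Fin d → ℝ) → ℝ}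
    {g2 : Fin d → Fin d → (Fin d → ℝ) → ℝ} {g3 : Fin d → Fin d → Fin d → (Fin d → ℝ) → ℝ}
    (H : SmoothTest g g1 g2 g3) (i : Fin d) {c : ℝ} (hc : 0 ≤ c) (b : Fin d → ℝ) :
    SmoothBound (fun x => g1 i (c • x + b)) (fun j x => c * g2 i j (c • x + b))
      (fun j l x => c * (c * g3 i j l (c • x + b))) 1 c (c ^ 2) (c ^ 3) where
  hasFDerivAt := hasFDerivAt_comp_affine (H.hasFDerivAt1 i) c b
  hasFDerivAt' j x := by
    refine ((hasFDerivAt_comp_affine (H.hasFDerivAt2 i j) c b x).const_mul c).congr_fderiv ?_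
    simp [Finset.smul_sum, smul_smul]
  bound0 x := H.bound1 i _
  bound1 j x := by
    rw [abs_mul, abs_of_nonneg hc]
    exact mul_le_of_le_one_right hc (H.bound2 i j _)
  bound2 j l x := by
    rw [abs_mul, abs_mul, abs_of_nonneg hc, ← mul_assoc, ← sq]
    exact mul_le_of_le_one_right (sq_nonneg c) (H.bound3 i j l _)
  lipschitz2 j l x y := by
    rw [← mul_sub, ← mul_sub, abs_mul, abs_mul, abs_of_nonneg hc]
    have h1 := H.lipschitz3 i j l (c • x + b) (c • y + b)
    have h2 : ∑ m, |(c • x + b) m - (c • y + b) m| = c * ∑ m, |x m - y m| := by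
      rw [Finset.mul_sum]
      refine Finset.sum_congr rfl fun m _ => ?_
      simp [← mul_sub, abs_mul, abs_of_nonneg hc]
    rw [h2] at h1
    calc _ ≤ c * (c * (c * ∑ m, |x m - y m|)) := by gcongr
      _ = _ := by ring
  nonneg2 := sq_nonneg c
  nonneg3 := pow_nonneg hc 3

end Rademacher

namespace Rademacher

variable {d : ℕ}

lemma memLp_eval {γ : Measure (Fin d → ℝ)} [IsGaussian γ] (i : Fin d) :
    MemLp (fun x => x i) 2 γ :=
  IsGaussian.memLp_dual γ (ContinuousLinearMap.proj i) 2 (by simp)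

lemma hasDerivAt_rotate {f : (Fin d → ℝ) → ℝ} {f1 : Fin d → (Fin d → ℝ) → ℝ}
    (hf : ∀ x, HasFDerivAt f
      (∑ j, f1 j x • (ContinuousLinearMap.proj j : (Fin d → ℝ) →L[ℝ] ℝ)) x)
    (x y : Fin d → ℝ) (θ : ℝ) :
    HasDerivAt (fun θ => f (Real.cos θ • x + Real.sin θ • y))
      (∑ j, f1 j (Real.cos θ • x + Real.sin θ • y) *
        (-Real.sin θ * x j + Real.cos θ * y j)) θ := by
  have h1 : HasDerivAt (fun θ => Real.cos θ • x + Real.sin θ • y)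
      ((-Real.sin θ) • x + Real.cos θ • y) θ :=
    ((Real.hasDerivAt_cos θ).smul_const x).add ((Real.hasDerivAt_sin θ).smul_const y)
  exact ((hf _).comp_hasDerivAt θ h1).congr_deriv (by simp)

lemma abs_rotate_le (θ a b : ℝ) : |-Real.sin θ * a + Real.cos θ * b| ≤ |a| + |b| := by
  refine (abs_add_le _ _).trans ?_
  rw [abs_mul, abs_mul, abs_neg]
  exact add_le_add (mul_le_of_le_one_left (abs_nonneg _) (Real.abs_sin_le_one θ))
    (mul_le_of_le_one_left (abs_nonneg _) (Real.abs_cos_le_one θ))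

lemma abs_rotate_le' (θ a b : ℝ) : |-Real.cos θ * a + -Real.sin θ * b| ≤ |a| + |b| := by
  refine (abs_add_le _ _).trans ?_
  rw [abs_mul, abs_mul, abs_neg, abs_neg]
  exact add_le_add (mul_le_of_le_one_left (abs_nonneg _) (Real.abs_cos_le_one θ))
    (mul_le_of_le_one_left (abs_nonneg _) (Real.abs_sin_le_one θ))

/-- Gaussian integration by parts, for possibly degenerate covariance. -/
theorem gaussian_integration_by_parts {γ : Measure (Fin d → ℝ)} [IsGaussian γ]
    (hγ : ∀ i, ∫ x, x i ∂γ = 0) {f : (Fin d → ℝ) → ℝ} {f1 : Fin d → (Fin d → ℝ) → ℝ}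
    (hf : ∀ x, HasFDerivAt f
      (∑ j, f1 j x • (ContinuousLinearMap.proj j : (Fin d → ℝ) →L[ℝ] ℝ)) x)
    (hf1 : ∀ j, Continuous (f1 j)) {C0 C1 : ℝ} (h0 : ∀ x, |f x| ≤ C0) (h1 : ∀ j x, |f1 j x| ≤ C1)
    (i : Fin d) :
    ∫ x, f x * x i ∂γ = ∑ j, (∫ x, x i * x j ∂γ) * ∫ x, f1 j x ∂γ := by
  have hfc : Continuous f := continuous_iff_continuousAt.2 fun x => (hf x).continuousAt
  have hrot : ∀ θ, (γ.prod γ).map (ContinuousLinearMap.rotation θ) = γ.prod γ :=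
    IsGaussian.map_rotation_eq_self_of_forall_strongDual_eq_zero fun L => by
      have hL : ∀ x : Fin d → ℝ, L x = ∑ i, x i * L (Pi.single i 1) := fun x =>
        (congrArg L (pi_eq_sum_univ' x)).trans (by simp only [map_sum, map_smul, smul_eq_mul])
      rw [integral_congr_ae (Filter.Eventually.of_forall hL), integral_finsetSum _ fun i _ => ((memLp_eval i).integrable one_le_two).mul_const _]
      simp [integral_mul_const, hγ]
  have hx2 : ∀ i, MemLp (fun z : (Fin d → ℝ) × (Fin d → ℝ) => z.1 i) 2 (γ.prod γ) := fun i =>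
    (memLp_eval i).comp_fst γ
  have hy2 : ∀ i, MemLp (fun z : (Fin d → ℝ) × (Fin d → ℝ) => z.2 i) 2 (γ.prod γ) := fun i =>
    (memLp_eval i).comp_snd γ
  let Φ : ℝ → (Fin d → ℝ) × (Fin d → ℝ) → ℝ := fun θ z =>
    f (Real.cos θ • z.1 + Real.sin θ • z.2) * (-Real.sin θ * z.1 i + Real.cos θ * z.2 i)
  let Φ' : ℝ → (Fin d → ℝ) × (Fin d → ℝ) → ℝ := fun θ z =>
    (∑ j, f1 j (Real.cos θ • z.1 + Real.sin θ • z.2) *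
      (-Real.sin θ * z.1 j + Real.cos θ * z.2 j)) * (-Real.sin θ * z.1 i + Real.cos θ * z.2 i) +
    f (Real.cos θ • z.1 + Real.sin θ • z.2) * (-Real.cos θ * z.1 i + -Real.sin θ * z.2 i)
  have hΦ : ∀ θ, ∫ z, Φ θ z ∂(γ.prod γ) = 0 := by
    intro θ
    have e1 : ∫ z, Φ θ z ∂(γ.prod γ) = ∫ z, f z.1 * z.2 i
        ∂((γ.prod γ).map (ContinuousLinearMap.rotation θ)) := by
      rw [integral_map (by fun_prop)
        (Continuous.aestronglyMeasurable (by fun_prop))]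
      simp [Φ, ContinuousLinearMap.rotation_apply]
    rw [e1, hrot, integral_prod_mul (f := f) (g := fun y : Fin d → ℝ => y i), hγ, mul_zero]
  have hd : ∀ θ z, HasDerivAt (Φ · z) (Φ' θ z) θ := by
    intro θ z
    have d2 : HasDerivAt (fun θ => -Real.sin θ * z.1 i + Real.cos θ * z.2 i)
        (-Real.cos θ * z.1 i + -Real.sin θ * z.2 i) θ :=
      ((Real.hasDerivAt_sin θ).neg.mul_const _).add ((Real.hasDerivAt_cos θ).mul_const _)
    exact (hasDerivAt_rotate hf z.1 z.2 θ).mul d2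
  let bound : (Fin d → ℝ) × (Fin d → ℝ) → ℝ := fun z =>
    (∑ j, C1 * (|z.1 j| + |z.2 j|)) * (|z.1 i| + |z.2 i|) + C0 * (|z.1 i| + |z.2 i|)
  have hbound : ∀ θ z, ‖Φ' θ z‖ ≤ bound z := by
    intro θ z
    have hC0 : 0 ≤ C0 := (abs_nonneg _).trans (h0 0)
    have hC1 : ∀ j : Fin d, 0 ≤ C1 := fun j => (abs_nonneg _).trans (h1 j 0)
    refine (norm_add_le _ _).trans (add_le_add ?_ ?_)
    · rw [Real.norm_eq_abs, abs_mul]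
      refine mul_le_mul ((Finset.abs_sum_le_sum_abs _ _).trans (Finset.sum_le_sum fun j _ => ?_))
        (abs_rotate_le _ _ _) (abs_nonneg _) (Finset.sum_nonneg fun j _ =>
          mul_nonneg (hC1 j) (by positivity))
      rw [abs_mul]
      exact mul_le_mul (h1 j _) (abs_rotate_le _ _ _) (abs_nonneg _) (hC1 j)
    · rw [Real.norm_eq_abs, abs_mul]
      exact mul_le_mul (h0 _) (abs_rotate_le' _ _ _) (abs_nonneg _) hC0
  have hs2 : ∀ j, MemLp (fun z : (Fin d → ℝ) × (Fin d → ℝ) => |z.1 j| + |z.2 j|) 2 (γ.prod γ) :=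
    fun j => (hx2 j).abs.add (hy2 j).abs
  have hbi : Integrable bound (γ.prod γ) := by
    refine Integrable.add ?_ (((hs2 i).integrable one_le_two).const_mul C0)
    simp only [Finset.sum_mul, mul_assoc]
    exact integrable_finsetSum _ fun j _ => ((hs2 j).integrable_mul (hs2 i)).const_mul C1
  have hΦc : ∀ θ, Continuous (Φ θ) := fun θ => by
    simp only [Φ]
    fun_prop
  have hΦ'c : ∀ θ, Continuous (Φ' θ) := fun θ => by
    simp only [Φ']
    fun_prop
  have hder := (hasDerivAt_integral_of_dominated_loc_of_deriv_le (μ := γ.prod γ) (F := Φ)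
    (F' := Φ') (x₀ := 0) (s := Set.univ) (bound := bound) Filter.univ_mem
    (Filter.Eventually.of_forall fun θ => (hΦc θ).aestronglyMeasurable)
    (by
      refine ((hy2 i).integrable one_le_two |>.bdd_mul (c := C0) (f := fun z => f z.1)
        (hfc.comp continuous_fst).aestronglyMeasurable
        (Filter.Eventually.of_forall fun z => h0 _)).congr
          (Filter.Eventually.of_forall fun z => ?_)
      simp [Φ])
    (hΦ'c 0).aestronglyMeasurable
    (Filter.Eventually.of_forall fun z θ _ => hbound θ z) hbi
    (Filter.Eventually.of_forall fun z θ _ => hd θ z)).2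
  simp only [hΦ] at hder
  have hzero : ∫ z, Φ' 0 z ∂(γ.prod γ) = 0 := hder.unique (hasDerivAt_const 0 0)
  have e2 : ∀ z, Φ' 0 z = (∑ j, f1 j z.1 * (z.2 i * z.2 j)) - f z.1 * z.1 i := by
    intro z
    simp only [Φ', Real.cos_zero, Real.sin_zero, Finset.sum_mul]
    simp only [one_smul, zero_smul, add_zero, neg_zero, zero_mul, zero_add, one_mul, neg_mul,
      mul_neg, sub_eq_add_neg]
    congr 1
    exact Finset.sum_congr rfl fun j _ => by ring
  simp only [e2] at hzero
  have i1 : ∀ j, Integrable (fun z : (Fin d → ℝ) × (Fin d → ℝ) => f1 j z.1 * (z.2 i * z.2 j))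
      (γ.prod γ) := fun j =>
    ((hy2 i).integrable_mul (hy2 j)).bdd_mul (c := C1)
      ((hf1 j).comp continuous_fst).aestronglyMeasurable
      (Filter.Eventually.of_forall fun z => h1 j _)
  have i2 : Integrable (fun z : (Fin d → ℝ) × (Fin d → ℝ) => f z.1 * z.1 i) (γ.prod γ) :=
    ((hx2 i).integrable one_le_two).bdd_mul (c := C0)
      (hfc.comp continuous_fst).aestronglyMeasurable (Filter.Eventually.of_forall fun z => h0 _)
  rw [integral_sub (integrable_finsetSum _ fun j _ => i1 j) i2,
    integral_finsetSum _ fun j _ => i1 j] at hzero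
  have e3 : ∫ z : (Fin d → ℝ) × (Fin d → ℝ), f z.1 * z.1 i ∂(γ.prod γ) = ∫ x, f x * x i ∂γ := by
    simpa using integral_fun_fst (μ := γ) (ν := γ) (f := fun x : Fin d → ℝ => f x * x i)
  rw [e3] at hzero
  rw [← sub_eq_zero.1 hzero]
  refine Finset.sum_congr rfl fun j _ => ?_
  rw [integral_prod_mul (f := f1 j) (g := fun y : Fin d → ℝ => y i * y j), mul_comm]

end Rademacher

namespace Rademacher

variable {d : ℕ} {g : (Fin d → ℝ) → ℝ} {g1 : Fin d → (Fin d → ℝ) → ℝ}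
  {g2 : Fin d → Fin d → (Fin d → ℝ) → ℝ} {g3 : Fin d → Fin d → Fin d → (Fin d → ℝ) → ℝ}

lemma SmoothTest.continuous (H : SmoothTest g g1 g2 g3) : Continuous g :=
  continuous_iff_continuousAt.2 fun x => (H.hasFDerivAt x).continuousAt

lemma SmoothTest.continuous1 (H : SmoothTest g g1 g2 g3) (i : Fin d) : Continuous (g1 i) :=
  continuous_iff_continuousAt.2 fun x => (H.hasFDerivAt1 i x).continuousAt

lemma SmoothTest.continuous2 (H : SmoothTest g g1 g2 g3) (i j : Fin d) : Continuous (g2 i j) :=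
  continuous_iff_continuousAt.2 fun x => (H.hasFDerivAt2 i j x).continuousAt

/-- `⟨DF_j, -DL⁻¹F_i⟩`. -/
def innerD (p : SuccessProb) (F : Fin d → Omega → ℝ) (i j : Fin d) (ω : Omega) : ℝ :=
  ∑' k, D p k (F j) ω * negDLInv p k (F i) ω

/-- The interpolation `cos θ F + sin θ y`, with general coefficients. -/
def interp (F : Fin d → Omega → ℝ) (c s : ℝ) (z : Omega × (Fin d → ℝ)) : Fin d → ℝ :=
  c • (fun i => F i z.1) + s • z.2

lemma aemeasurable_interp {p : SuccessProb} {F : Fin d → Omega → ℝ}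
    (hF : ∀ i, MemLp (F i) 2 (P p)) (γ : Measure (Fin d → ℝ)) [IsProbabilityMeasure γ] (c s : ℝ) :
    AEMeasurable (interp F c s) ((P p).prod γ) :=
  (((aemeasurable_vec hF).comp_quasiMeasurePreserving
    Measure.quasiMeasurePreserving_fst).const_smul c).add
      (measurable_snd.const_smul s).aemeasurable

lemma aestronglyMeasurable_comp_interp {p : SuccessProb} {F : Fin d → Omega → ℝ}
    (hF : ∀ i, MemLp (F i) 2 (P p)) (γ : Measure (Fin d → ℝ)) [IsProbabilityMeasure γ] (c s : ℝ)
    {f : (Fin d → ℝ) → ℝ} (hf : Continuous f) :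
    AEStronglyMeasurable (fun z => f (interp F c s z)) ((P p).prod γ) :=
  (hf.measurable.comp_aemeasurable (aemeasurable_interp hF γ c s)).aestronglyMeasurable

lemma memLp_fst {p : SuccessProb} {F : Fin d → Omega → ℝ} (hF : ∀ i, MemLp (F i) 2 (P p))
    (γ : Measure (Fin d → ℝ)) [IsProbabilityMeasure γ] (i : Fin d) :
    MemLp (fun z : Omega × (Fin d → ℝ) => F i z.1) 2 ((P p).prod γ) :=
  (hF i).comp_fst γ

lemma memLp_snd (p : SuccessProb) (γ : Measure (Fin d → ℝ)) [IsGaussian γ] (i : Fin d) :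
    MemLp (fun z : Omega × (Fin d → ℝ) => z.2 i) 2 ((P p).prod γ) :=
  (memLp_eval i).comp_snd (P p)

lemma SmoothTest.integral_snd (H : SmoothTest g g1 g2 g3) {p : SuccessProb}
    {F : Fin d → Omega → ℝ} (hF : ∀ i, MemLp (F i) 2 (P p)) {γ : Measure (Fin d → ℝ)}
    [IsGaussian γ] (hγ : ∀ i, ∫ x, x i ∂γ = 0) (c s : ℝ) (i : Fin d) :
    ∫ z, g1 i (interp F c s z) * z.2 i ∂((P p).prod γ) =
      s * ∑ j, (∫ x, x i * x j ∂γ) * ∫ z, g2 i j (interp F c s z) ∂((P p).prod γ) := by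
  have i1 : Integrable (fun z => g1 i (interp F c s z) * z.2 i) ((P p).prod γ) :=
    ((memLp_snd p γ i).integrable one_le_two).bdd_mul (c := 1)
      (aestronglyMeasurable_comp_interp hF γ c s (H.continuous1 i))
      (Filter.Eventually.of_forall fun z => H.bound1 i _)
  have i2 : ∀ j, Integrable (fun z => g2 i j (interp F c s z)) ((P p).prod γ) := fun j =>
    Integrable.of_bound (aestronglyMeasurable_comp_interp hF γ c s (H.continuous2 i j)) 1
      (Filter.Eventually.of_forall fun z => H.bound2 i j _)
  rw [integral_prod _ i1]
  have e1 : ∀ ω, ∫ y, g1 i (interp F c s (ω, y)) * y i ∂γ =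
      ∑ j, (∫ x, x i * x j ∂γ) * ∫ y, s * g2 i j (interp F c s (ω, y)) ∂γ := by
    intro ω
    have := gaussian_integration_by_parts hγ (f := fun y => g1 i (s • y + c • fun i => F i ω))
      (f1 := fun j y => s * g2 i j (s • y + c • fun i => F i ω))
      (hasFDerivAt_comp_affine (H.hasFDerivAt1 i) s _)
      (fun j => by have := H.continuous2 i j; fun_prop) (C0 := 1) (C1 := |s|)
      (fun y => H.bound1 i _) (fun j y => by
        rw [abs_mul]
        exact mul_le_of_le_one_right (abs_nonneg s) (H.bound2 i j _)) i
    simpa only [interp, add_comm] using this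
  simp only [e1, integral_const_mul]
  rw [integral_finsetSum _ fun j _ => ((i2 j).integral_prod_left.const_mul s).const_mul _]
  rw [Finset.mul_sum]
  refine Finset.sum_congr rfl fun j _ => ?_
  rw [integral_const_mul, integral_const_mul, integral_prod _ (i2 j)]
  ring

lemma integrable_comp_interp_mul {p : SuccessProb} {F : Fin d → Omega → ℝ}
    (hF : ∀ i, MemLp (F i) 2 (P p)) (γ : Measure (Fin d → ℝ)) [IsProbabilityMeasure γ] (c s : ℝ)
    {f : (Fin d → ℝ) → ℝ} (hf : Continuous f) (hb : ∀ x, |f x| ≤ 1) {G : Omega → ℝ}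
    (hG : Integrable G (P p)) :
    Integrable (fun z => f (interp F c s z) * G z.1) ((P p).prod γ) :=
  (hG.comp_fst γ).bdd_mul (c := 1) (aestronglyMeasurable_comp_interp hF γ c s hf)
    (Filter.Eventually.of_forall fun _ => hb _)

lemma SmoothTest.abs_integral_fst_sub_le (H : SmoothTest g g1 g2 g3) {p : SuccessProb}
    {F : Fin d → Omega → ℝ} (hF : ∀ i, DomD p (F i))
    (hF4 : ∀ i k, Integrable (fun ω => D p k (F i) ω ^ 4) (P p))
    (hF0 : ∀ i, ∫ ω, F i ω ∂(P p) = 0) (γ : Measure (Fin d → ℝ)) [IsProbabilityMeasure γ]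
    {c : ℝ} (hc : 0 ≤ c) (s : ℝ) (i : Fin d) (h2 : secondOrderBound p F (F i) ≠ ∞)
    (h3 : thirdOrderBound p F (F i) ≠ ∞) :
    |(∫ z, g1 i (interp F c s z) * F i z.1 ∂((P p).prod γ)) -
      c * ∑ j, ∫ z, g2 i j (interp F c s z) * innerD p F i j z.1 ∂((P p).prod γ)| ≤
      c ^ 2 / 2 * (secondOrderBound p F (F i)).toReal +
        5 / 12 * c ^ 3 * (thirdOrderBound p F (F i)).toReal := by
  have hF2 : ∀ i, MemLp (F i) 2 (P p) := fun i => (hF i).1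
  have i1 := integrable_comp_interp_mul hF2 γ c s (H.continuous1 i) (H.bound1 i)
    ((hF2 i).integrable one_le_two)
  have i2 : ∀ j, Integrable (fun z => g2 i j (interp F c s z) * innerD p F i j z.1)
      ((P p).prod γ) := fun j =>
    integrable_comp_interp_mul hF2 γ c s (H.continuous2 i j) (H.bound2 i j)
      (integrable_tsum_D_mul_negDLInv (hF2 i) (hF j))
  have e1 : (∫ z, g1 i (interp F c s z) * F i z.1 ∂((P p).prod γ)) -
      c * ∑ j, ∫ z, g2 i j (interp F c s z) * innerD p F i j z.1 ∂((P p).prod γ) =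
      ∫ y, ((∫ ω, g1 i (interp F c s (ω, y)) * F i ω ∂(P p)) -
        ∑ j, c * ∫ ω, g2 i j (interp F c s (ω, y)) * innerD p F i j ω ∂(P p)) ∂γ := by
    rw [integral_prod_symm _ i1, integral_sub i1.integral_prod_right
      (integrable_finsetSum _ fun j _ => (i2 j).integral_prod_right.const_mul c),
      integral_finsetSum _ fun j _ => (i2 j).integral_prod_right.const_mul c, Finset.mul_sum]
    congr 1
    refine Finset.sum_congr rfl fun j _ => ?_
    rw [integral_prod_symm _ (i2 j), integral_const_mul]
  rw [e1]
  have hb : ∀ y, ‖(∫ ω, g1 i (interp F c s (ω, y)) * F i ω ∂(P p)) -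
        ∑ j, c * ∫ ω, g2 i j (interp F c s (ω, y)) * innerD p F i j ω ∂(P p)‖ ≤
      c ^ 2 / 2 * (secondOrderBound p F (F i)).toReal +
        5 / 12 * c ^ 3 * (thirdOrderBound p F (F i)).toReal := by
    intro y
    have h := (H.smoothBound i hc (s • y)).enorm_integral_mul_sub_le hF hF4 (hF2 i) (hF0 i)
    simp only [mul_assoc, integral_const_mul] at h
    have hfin : ENNReal.ofReal (c ^ 2 / 2) * secondOrderBound p F (F i) +
        ENNReal.ofReal (5 / 12 * c ^ 3) * thirdOrderBound p F (F i) ≠ ∞ :=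
      ENNReal.add_ne_top.2 ⟨ENNReal.mul_ne_top ENNReal.ofReal_ne_top h2,
        ENNReal.mul_ne_top ENNReal.ofReal_ne_top h3⟩
    have h' := ENNReal.toReal_mono hfin h
    rw [toReal_enorm, ENNReal.toReal_add (ENNReal.mul_ne_top ENNReal.ofReal_ne_top h2)
      (ENNReal.mul_ne_top ENNReal.ofReal_ne_top h3), ENNReal.toReal_mul, ENNReal.toReal_mul,
      ENNReal.toReal_ofReal (by positivity), ENNReal.toReal_ofReal (by positivity)] at h'
    exact h'
  simpa using norm_integral_le_of_norm_le_const (μ := γ) (Filter.Eventually.of_forall hb)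

lemma SmoothTest.integrable_comp_interp (H : SmoothTest g g1 g2 g3) {p : SuccessProb}
    {F : Fin d → Omega → ℝ} (hF : ∀ i, MemLp (F i) 2 (P p)) (γ : Measure (Fin d → ℝ))
    [IsGaussian γ] (c s : ℝ) : Integrable (fun z => g (interp F c s z)) ((P p).prod γ) := by
  have hb : Integrable (fun z : Omega × (Fin d → ℝ) => |g 0| + ∑ i, (|c| * |F i z.1| +
      |s| * |z.2 i|)) ((P p).prod γ) :=
    (integrable_const _).add (integrable_finsetSum _ fun i _ =>
      (((memLp_fst hF γ i).integrable one_le_two).abs.const_mul _).add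
        (((memLp_snd p γ i).integrable one_le_two).abs.const_mul _))
  refine hb.mono' (aestronglyMeasurable_comp_interp hF γ c s H.continuous)
    (Filter.Eventually.of_forall fun z => ?_)
  have h1 := H.lipschitz (interp F c s z) 0
  have h2 : ∑ i, |interp F c s z i - (0 : Fin d → ℝ) i| ≤
      ∑ i, (|c| * |F i z.1| + |s| * |z.2 i|) := by
    refine Finset.sum_le_sum fun i _ => ?_
    simp only [interp, Pi.add_apply, Pi.smul_apply, smul_eq_mul, Pi.zero_apply, sub_zero,
      ← abs_mul]
    exact abs_add_le _ _
  rw [Real.norm_eq_abs]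
  have h3 := abs_add_le (g (interp F c s z) - g 0) (g 0)
  rw [sub_add_cancel] at h3
  linarith

lemma SmoothTest.hasDerivAt_integral (H : SmoothTest g g1 g2 g3) {p : SuccessProb}
    {F : Fin d → Omega → ℝ} (hF : ∀ i, MemLp (F i) 2 (P p)) (γ : Measure (Fin d → ℝ))
    [IsGaussian γ] (θ : ℝ) :
    HasDerivAt (fun θ => ∫ z, g (interp F (Real.cos θ) (Real.sin θ) z) ∂((P p).prod γ))
      (∑ i, (-Real.sin θ * ∫ z, g1 i (interp F (Real.cos θ) (Real.sin θ) z) * F i z.1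
          ∂((P p).prod γ) +
        Real.cos θ * ∫ z, g1 i (interp F (Real.cos θ) (Real.sin θ) z) * z.2 i
          ∂((P p).prod γ))) θ := by
  have i1 : ∀ i, Integrable (fun z => g1 i (interp F (Real.cos θ) (Real.sin θ) z) * F i z.1)
      ((P p).prod γ) := fun i =>
    integrable_comp_interp_mul hF γ _ _ (H.continuous1 i) (H.bound1 i)
      ((hF i).integrable one_le_two)
  have i2 : ∀ i, Integrable (fun z => g1 i (interp F (Real.cos θ) (Real.sin θ) z) * z.2 i)
      ((P p).prod γ) := fun i =>
    ((memLp_snd p γ i).integrable one_le_two).bdd_mul (c := 1)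
      (aestronglyMeasurable_comp_interp hF γ _ _ (H.continuous1 i))
      (Filter.Eventually.of_forall fun z => H.bound1 i _)
  have e1 : ∀ z : Omega × (Fin d → ℝ), ∑ i, g1 i (interp F (Real.cos θ) (Real.sin θ) z) *
      (-Real.sin θ * F i z.1 + Real.cos θ * z.2 i) =
      ∑ i, (-Real.sin θ * (g1 i (interp F (Real.cos θ) (Real.sin θ) z) * F i z.1) +
        Real.cos θ * (g1 i (interp F (Real.cos θ) (Real.sin θ) z) * z.2 i)) := fun z =>
    Finset.sum_congr rfl fun i _ => by ring
  have i3 : ∀ i, Integrable (fun z : Omega × (Fin d → ℝ) =>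
      -Real.sin θ * (g1 i (interp F (Real.cos θ) (Real.sin θ) z) * F i z.1) +
        Real.cos θ * (g1 i (interp F (Real.cos θ) (Real.sin θ) z) * z.2 i)) ((P p).prod γ) :=
    fun i => ((i1 i).const_mul _).add ((i2 i).const_mul _)
  have hb : Integrable (fun z : Omega × (Fin d → ℝ) => ∑ i, (|F i z.1| + |z.2 i|))
      ((P p).prod γ) := integrable_finsetSum _ fun i _ =>
    ((memLp_fst hF γ i).integrable one_le_two).abs.add
      ((memLp_snd p γ i).integrable one_le_two).abs
  have h := (hasDerivAt_integral_of_dominated_loc_of_deriv_le (μ := (P p).prod γ)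
    (F := fun θ z => g (interp F (Real.cos θ) (Real.sin θ) z))
    (F' := fun θ z => ∑ i, g1 i (interp F (Real.cos θ) (Real.sin θ) z) *
      (-Real.sin θ * F i z.1 + Real.cos θ * z.2 i)) (x₀ := θ) (s := Set.univ) Filter.univ_mem
    (Filter.Eventually.of_forall fun θ =>
      aestronglyMeasurable_comp_interp hF γ _ _ H.continuous)
    (H.integrable_comp_interp hF γ _ _)
    (by
      simp only [e1]
      exact (integrable_finsetSum _ fun i _ => i3 i).aestronglyMeasurable)
    (Filter.Eventually.of_forall fun z θ _ => by
      refine (norm_sum_le _ _).trans (Finset.sum_le_sum fun i _ => ?_)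
      rw [Real.norm_eq_abs, abs_mul]
      exact (mul_le_of_le_one_left (abs_nonneg _) (H.bound1 i _)).trans (abs_rotate_le _ _ _))
    hb
    (Filter.Eventually.of_forall fun z θ _ =>
      hasDerivAt_rotate H.hasFDerivAt (fun i => F i z.1) z.2 θ)).2
  refine h.congr_deriv ?_
  simp only [e1]
  rw [integral_finsetSum _ fun i _ => i3 i]
  refine Finset.sum_congr rfl fun i _ => ?_
  rw [integral_add ((i1 i).const_mul _) ((i2 i).const_mul _), integral_const_mul,
    integral_const_mul]

/-- The bound along the smart path. -/
theorem SmoothTest.abs_integral_sub_integral_le (H : SmoothTest g g1 g2 g3) {p : SuccessProb}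
    {F : Fin d → Omega → ℝ} (hF : ∀ i, DomD p (F i))
    (hF4 : ∀ i k, Integrable (fun ω => D p k (F i) ω ^ 4) (P p))
    (hF0 : ∀ i, ∫ ω, F i ω ∂(P p) = 0) {γ : Measure (Fin d → ℝ)} [IsGaussian γ]
    (hγ : ∀ i, ∫ x, x i ∂γ = 0) {S : Matrix (Fin d) (Fin d) ℝ}
    (hS : ∀ i j, ∫ x, x i * x j ∂γ = S i j) (h2 : ∀ i, secondOrderBound p F (F i) ≠ ∞)
    (h3 : ∀ i, thirdOrderBound p F (F i) ≠ ∞) :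
    |(∫ ω, g (fun i => F i ω) ∂(P p)) - ∫ x, g x ∂γ| ≤
      1 / 2 * ∑ i, ∑ j, ∫ ω, |S i j - innerD p F i j ω| ∂(P p) +
      1 / 4 * ∑ i, (secondOrderBound p F (F i)).toReal +
      5 / 24 * ∑ i, (thirdOrderBound p F (F i)).toReal := by
  have hF2 : ∀ i, MemLp (F i) 2 (P p) := fun i => (hF i).1
  set a : Fin d → Fin d → ℝ := fun i j => ∫ ω, |S i j - innerD p F i j ω| ∂(P p) with ha
  set b : Fin d → ℝ := fun i => (secondOrderBound p F (F i)).toReal with hb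
  set e : Fin d → ℝ := fun i => (thirdOrderBound p F (F i)).toReal with he
  set A : ℝ := 1 / 2 * ∑ i, ∑ j, a i j + 1 / 4 * ∑ i, b i + 5 / 24 * ∑ i, e i with hA
  let Ψ : ℝ → ℝ := fun θ => ∫ z, g (interp F (Real.cos θ) (Real.sin θ) z) ∂((P p).prod γ)
  let Ψ' : ℝ → ℝ := fun θ =>
    ∑ i, (-Real.sin θ * ∫ z, g1 i (interp F (Real.cos θ) (Real.sin θ) z) * F i z.1
          ∂((P p).prod γ) +
        Real.cos θ * ∫ z, g1 i (interp F (Real.cos θ) (Real.sin θ) z) * z.2 i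
          ∂((P p).prod γ))
  have hT : ∀ i j, Integrable (innerD p F i j) (P p) := fun i j =>
    integrable_tsum_D_mul_negDLInv (hF2 i) (hF j)
  have hder : ∀ θ, HasDerivAt Ψ (Ψ' θ) θ := fun θ => H.hasDerivAt_integral hF2 γ θ
  have hbound : ∀ θ, 0 ≤ Real.sin θ → 0 ≤ Real.cos θ →
      |Ψ' θ| ≤ A * (2 * Real.sin θ * Real.cos θ) := by
    intro θ hs hc
    set s := Real.sin θ
    set c := Real.cos θ
    have hc1 : c ≤ 1 := Real.cos_le_one θ
    have hterm : ∀ i, |-s * ∫ z, g1 i (interp F c s z) * F i z.1 ∂((P p).prod γ) +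
        c * ∫ z, g1 i (interp F c s z) * z.2 i ∂((P p).prod γ)| ≤
        s * c * ∑ j, a i j + s * c * (1 / 2 * b i + 5 / 12 * e i) := by
      intro i
      have h4 := H.abs_integral_fst_sub_le hF hF4 hF0 γ hc s i (h2 i) (h3 i)
      have h5 := H.integral_snd hF2 hγ c s i
      simp only [hS] at h5
      have h6 : ∀ j, |(∫ z, g2 i j (interp F c s z) * (S i j - innerD p F i j z.1)
          ∂((P p).prod γ))| ≤ a i j := by
        intro j
        have hST : Integrable (fun ω => S i j - innerD p F i j ω) (P p) :=
          (integrable_const _).sub (hT i j)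
        have e1 : a i j = ∫ z : Omega × (Fin d → ℝ), |S i j - innerD p F i j z.1|
            ∂((P p).prod γ) := by
          simpa using (integral_fun_fst (μ := P p) (ν := γ)
            (f := fun ω => |S i j - innerD p F i j ω|)).symm
        rw [e1]
        refine (norm_integral_le_integral_norm _).trans (integral_mono
          (integrable_comp_interp_mul hF2 γ c s (H.continuous2 i j) (H.bound2 i j) hST).norm
          (hST.comp_fst γ).abs fun z => ?_)
        simp only [Real.norm_eq_abs, abs_mul]
        exact mul_le_of_le_one_left (abs_nonneg _) (H.bound2 i j _)
      have h7 : ∀ j, ∫ z, g2 i j (interp F c s z) * (S i j - innerD p F i j z.1)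
          ∂((P p).prod γ) = S i j * ∫ z, g2 i j (interp F c s z) ∂((P p).prod γ) -
          ∫ z, g2 i j (interp F c s z) * innerD p F i j z.1 ∂((P p).prod γ) := by
        intro j
        have i2 : Integrable (fun z => g2 i j (interp F c s z)) ((P p).prod γ) :=
          Integrable.of_bound (aestronglyMeasurable_comp_interp hF2 γ c s (H.continuous2 i j)) 1
            (Filter.Eventually.of_forall fun z => H.bound2 i j _)
        rw [← integral_const_mul, ← integral_sub (i2.const_mul _)
          (integrable_comp_interp_mul hF2 γ c s (H.continuous2 i j) (H.bound2 i j) (hT i j))]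
        refine integral_congr_ae (Filter.Eventually.of_forall fun z => ?_)
        simp only
        ring
      have h8 : |∑ j, ∫ z, g2 i j (interp F c s z) * (S i j - innerD p F i j z.1)
          ∂((P p).prod γ)| ≤ ∑ j, a i j :=
        (Finset.abs_sum_le_sum_abs _ _).trans (Finset.sum_le_sum fun j _ => h6 j)
      simp only [h7, Finset.sum_sub_distrib] at h8
      rw [h5]
      set U := ∫ z, g1 i (interp F c s z) * F i z.1 ∂((P p).prod γ)
      set V := ∑ j, ∫ z, g2 i j (interp F c s z) * innerD p F i j z.1 ∂((P p).prod γ)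
      set W := ∑ j, S i j * ∫ z, g2 i j (interp F c s z) ∂((P p).prod γ)
      have e2 : -s * U + c * (s * W) = s * c * (W - V) - s * (U - c * V) := by ring
      have hb0 : 0 ≤ b i := ENNReal.toReal_nonneg
      have he0 : 0 ≤ e i := ENNReal.toReal_nonneg
      have h9 : c ^ 2 / 2 * b i + 5 / 12 * c ^ 3 * e i ≤ c * (1 / 2 * b i + 5 / 12 * e i) := by
        have h10 : c ^ 2 ≤ c := by nlinarith
        have h11 : c ^ 3 ≤ c := by nlinarith
        nlinarith [mul_le_mul_of_nonneg_right h10 hb0, mul_le_mul_of_nonneg_right h11 he0]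
      rw [e2]
      refine (abs_sub _ _).trans (add_le_add ?_ ?_)
      · rw [abs_mul, abs_of_nonneg (mul_nonneg hs hc)]
        exact mul_le_mul_of_nonneg_left h8 (mul_nonneg hs hc)
      · rw [abs_mul, abs_of_nonneg hs, mul_assoc]
        exact mul_le_mul_of_nonneg_left (h4.trans h9) hs
    calc |Ψ' θ| ≤ ∑ i, (s * c * ∑ j, a i j + s * c * (1 / 2 * b i + 5 / 12 * e i)) :=
          (Finset.abs_sum_le_sum_abs _ _).trans (Finset.sum_le_sum fun i _ => hterm i)
      _ = A * (2 * s * c) := by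
          simp only [hA, Finset.sum_add_distrib, ← Finset.mul_sum]
          ring
  have hB : ∀ θ, HasDerivAt (fun θ => A * Real.sin θ ^ 2)
      (A * (2 * Real.sin θ * Real.cos θ)) θ := fun θ =>
    (((Real.hasDerivAt_sin θ).pow 2).const_mul A).congr_deriv (by simp)
  have hmain := image_norm_le_of_norm_deriv_right_le_deriv_boundary (a := 0) (b := Real.pi / 2)
    (f := fun θ => Ψ θ - Ψ 0) (f' := Ψ')
    (fun θ _ => ((hder θ).sub_const _).continuousAt.continuousWithinAt)
    (fun θ _ => ((hder θ).sub_const _).hasDerivWithinAt) (B := fun θ => A * Real.sin θ ^ 2)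
    (by simp) hB (fun θ hθ => hbound θ
      (Real.sin_nonneg_of_nonneg_of_le_pi hθ.1 (by linarith [hθ.2, Real.pi_pos]))
      (Real.cos_nonneg_of_neg_pi_div_two_le_of_le (by linarith [hθ.1, Real.pi_pos]) hθ.2.le))
    (Set.right_mem_Icc.2 (by positivity))
  have e0 : Ψ 0 = ∫ ω, g (fun i => F i ω) ∂(P p) := by
    have := integral_fun_fst (μ := P p) (ν := γ) (f := fun ω => g (fun i => F i ω))
    simpa [Ψ, interp] using this
  have e1 : Ψ (Real.pi / 2) = ∫ x, g x ∂γ := by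
    have := integral_fun_snd (μ := P p) (ν := γ) (f := g)
    simpa [Ψ, interp] using this
  rw [e0, e1, Real.sin_pi_div_two] at hmain
  rw [abs_sub_comm]
  simpa using hmain

end Rademacher

end

theorem mainTheorem1 (p : Rademacher.SuccessProb) (d : ℕ) (F : Fin d → Rademacher.Omega → ℝ)
    (hF : ∀ i, Rademacher.DomD p (F i))
    (hF0 : ∀ i, ∫ ω, F i ω ∂(Rademacher.P p) = 0)
    (hF4 : ∀ i, ∫⁻ ω, ∑' k : ℕ, ENNReal.ofReal
      (|(Rademacher.pq p k) ^ (-(1 / 4) : ℝ) * Rademacher.D p k (F i) ω| ^ 4)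
        ∂(Rademacher.P p) < ∞)
    (S : Matrix (Fin d) (Fin d) ℝ) (hS : S.PosSemidef)
    {Ω' : Type*} [MeasurableSpace Ω'] (P' : Measure Ω') [IsProbabilityMeasure P']
    (N : Ω' → Fin d → ℝ) (hN : HasGaussianLaw N P')
    (hN0 : ∀ i, ∫ ω, N ω i ∂P' = 0)
    (hNS : ∀ i j, covariance (fun ω => N ω i) (fun ω => N ω j) P' = S i j) :
    Rademacher.d4 (fun ω i => F i ω) (Rademacher.P p) N P' ≤
      Rademacher.A1 p F S + Rademacher.A2 p F + Rademacher.A3 p F := by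
  open Rademacher in
  have hF2 : ∀ i, MemLp (F i) 2 (P p) := fun i => (hF i).1
  have hD4 := fun i k => integrable_D_pow_four (hF2 i) (hF4 i) k
  have hNm : AEMeasurable N P' := hN.aemeasurable
  have : IsGaussian (P'.map N) := hN.isGaussian_map
  have hγ : ∀ i, ∫ x, x i ∂(P'.map N) = 0 := fun i => by
    rw [integral_map hNm (Continuous.aestronglyMeasurable (by fun_prop)), hN0]
  have hγS : ∀ i j, ∫ x, x i * x j ∂(P'.map N) = S i j := fun i j => by
    rw [integral_map hNm (Continuous.aestronglyMeasurable (by fun_prop)), ← hNS, covariance]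
    simp [hN0]
  rw [d4]
  refine iSup₂_le fun g hg => ?_
  obtain ⟨g1, g2, g3, H⟩ := exists_smoothTest hg
  rw [A2_eq hF2, A3_eq hF2]
  by_cases h2 : ∀ i, secondOrderBound p F (F i) ≠ ∞
  swap
  · push Not at h2
    obtain ⟨i, hi⟩ := h2
    have : ∑ i, secondOrderBound p F (F i) = ∞ := ENNReal.sum_eq_top.2 ⟨i, Finset.mem_univ _, hi⟩
    rw [this, ENNReal.mul_top (by simp)]
    simp
  by_cases h3 : ∀ i, thirdOrderBound p F (F i) ≠ ∞
  swap
  · push Not at h3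
    obtain ⟨i, hi⟩ := h3
    have : ∑ i, thirdOrderBound p F (F i) = ∞ := ENNReal.sum_eq_top.2 ⟨i, Finset.mem_univ _, hi⟩
    rw [this, ENNReal.mul_top (by simp)]
    simp
  have h := H.abs_integral_sub_integral_le hF hD4 hF0 hγ hγS h2 h3
  rw [integral_map hNm H.continuous.aestronglyMeasurable] at h
  refine (ENNReal.ofReal_le_ofReal h).trans_eq ?_
  have hT : ∀ i j, ∫⁻ ω, ENNReal.ofReal |S i j - ∑' k, D p k (F j) ω * negDLInv p k (F i) ω|
      ∂(P p) = ENNReal.ofReal (∫ ω, |S i j - innerD p F i j ω| ∂(P p)) := fun i j => by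
    rw [ofReal_integral_eq_lintegral_ofReal _ (Filter.Eventually.of_forall fun _ => abs_nonneg _)]
    · rfl
    · exact ((integrable_const _).sub (integrable_tsum_D_mul_negDLInv (hF2 i) (hF j))).abs
  have n1 : ∀ i j, 0 ≤ ∫ ω, |S i j - innerD p F i j ω| ∂(P p) := fun i j =>
    integral_nonneg fun _ => abs_nonneg _
  have n2 : 0 ≤ ∑ i, ∑ j, ∫ ω, |S i j - innerD p F i j ω| ∂(P p) :=
    Finset.sum_nonneg fun i _ => Finset.sum_nonneg fun j _ => n1 i j
  have n3 : 0 ≤ ∑ i, (secondOrderBound p F (F i)).toReal :=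
    Finset.sum_nonneg fun i _ => ENNReal.toReal_nonneg
  have n4 : 0 ≤ ∑ i, (thirdOrderBound p F (F i)).toReal :=
    Finset.sum_nonneg fun i _ => ENNReal.toReal_nonneg
  rw [ENNReal.ofReal_add (by positivity) (by positivity),
    ENNReal.ofReal_add (by positivity) (by positivity), ENNReal.ofReal_mul (by norm_num),
    ENNReal.ofReal_mul (by norm_num), ENNReal.ofReal_mul (by norm_num),
    ENNReal.ofReal_sum_of_nonneg fun i _ => ENNReal.toReal_nonneg,
    ENNReal.ofReal_sum_of_nonneg fun i _ => ENNReal.toReal_nonneg,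
    ENNReal.ofReal_sum_of_nonneg fun i _ => Finset.sum_nonneg fun j _ => n1 i j, A1]
  simp only [hT, ENNReal.ofReal_toReal (h2 _), ENNReal.ofReal_toReal (h3 _)]
  have c1 : ENNReal.ofReal (1 / 2) = 1 / 2 := by
    rw [ENNReal.ofReal_div_of_pos (by norm_num)]; simp
  have c2 : ENNReal.ofReal (1 / 4) = 1 / 4 := by
    rw [ENNReal.ofReal_div_of_pos (by norm_num)]; simp
  have c3 : ENNReal.ofReal (5 / 24) = 5 / 24 := by
    rw [ENNReal.ofReal_div_of_pos (by norm_num)]; simp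
  rw [c1, c2, c3]
  congr 3
  exact Finset.sum_congr rfl fun i _ => ENNReal.ofReal_sum_of_nonneg fun j _ => n1 i j
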